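/- Let $f$ be an analytic, injective function on the unit disk $\mathbb D$ with $f(0)=0$ and $f'(0)=1$ whose image $f(\mathbb D)$ is convex and unbounded, let $a_2=f''(0)/2$ be its second Taylor coefficient, and suppose $a_2\neq 0$. Then $1+a_2f$ has no zero in $\mathbb D$, and the function $$f^*=\frac{f}{1+a_2f}$$ satisfies $|a_2f^*(z)|<1$ for all $z\in\mathbb D$. Moreover $f^*$ extends continuously to $\overline{\mathbb D}$ (the extension is again denoted $f^*$), and $|a_2f^*(\zeta)|=1$ for some $\zeta\in\partial\mathbb D$. More precisely: (i) If $f(\mathbb D)$ is not a half-plane, not an infinite sector of opening angle in $(0,\pi)$ and not a parallel strip, then there is exactly one $\zeta\in\partial\mathbb D$ with $|a_2f^*(\zeta)|=1$, and $f(z)\to\infty$ as $z\to\zeta$, $z\in\mathbb D$. (ii) If $f(\mathbb D)$ is a parallel strip (necessarily one in which $0$ is not on the axis of symmetry, since $a_2\ne0$), then $|a_2f^*(\zeta)|=1$ for exactly two points $\zeta_1,\zeta_2\in\partial\mathbb D$, and $f(z)$ tends to one end of the strip as $z\to\zeta_1$ and to the other end as $z\to\zeta_2$, $z\in\mathbb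 D$. (iii) If $f(\mathbb D)$ is an infinite sector with vertex $v$ and opening angle in $(0,\pi)$, then $|a_2f^*(\zeta)|=1$ for exactly two points $\zeta_1,\zeta_2\in\partial\mathbb D$, and $f(z)\to v$ as $z\to\zeta_1$ and $f(z)\to\infty$ as $z\to\zeta_2$, $z\in\mathbb D$. (iv) If $f(\mathbb D)$ is a half-plane, then $|a_2f^*(\zeta)|=1$ for every $\zeta\in\partial\mathbb D$. -/

import Mathlib

open Filter Topology

/-- The class of normalized convex mappings of the unit disk: `f` is analytic and injective on the
open unit disk, `f 0 = 0`, `f' 0 = 1`, and the image of the disk is convex. -/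
structure IsConvexMapping (f : ℂ → ℂ) : Prop where
  differentiableOn : DifferentiableOn ℂ f (Metric.ball 0 1)
  injOn : Set.InjOn f (Metric.ball 0 1)
  map_zero : f 0 = 0
  deriv_zero : deriv f 0 = 1
  convex_image : Convex ℝ (f '' Metric.ball 0 1)

/-- The second Taylor coefficient of `f` at the origin. -/
noncomputable def secondCoeff (f : ℂ → ℂ) : ℂ := iteratedDeriv 2 f 0 / 2

/-- The Moebius shift `f* = f / (1 + a₂ f)`. -/
noncomputable def fStar (f : ℂ → ℂ) (z : ℂ) : ℂ := f z / (1 + secondCoeff f * f z)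

/-- The extension of `f*` to the closed disk by its limits from inside the open unit disk. -/
noncomputable def fStarExt (f : ℂ → ℂ) : ℂ → ℂ := extendFrom (Metric.ball 0 1) (fStar f)

/-- The open half-plane `Re (conj u * w) > c`; a half-plane as soon as `u ≠ 0`. -/
def halfPlane (u : ℂ) (c : ℝ) : Set ℂ := {w | c < ((starRingEnd ℂ) u * w).re}

/-- The open strip `c < Im (conj u * w) < d`, parallel to the direction `u ≠ 0`. -/
def parallelStrip (u : ℂ) (c d : ℝ) : Set ℂ :=
  {w | c < ((starRingEnd ℂ) u * w).im ∧ ((starRingEnd ℂ) u * w).im < d}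

/-- The open infinite sector with vertex `v`, axis in the direction `u ≠ 0` and opening
angle `α`. -/
def sector (v u : ℂ) (α : ℝ) : Set ℂ := {w | w ≠ v ∧ |((w - v) / u).arg| < α / 2}

/-- `S` is an open half-plane. -/
def IsHalfPlane (S : Set ℂ) : Prop := ∃ (u : ℂ) (c : ℝ), u ≠ 0 ∧ S = halfPlane u c

/-- `S` is an open parallel strip. -/
def IsParallelStrip (S : Set ℂ) : Prop :=
  ∃ (u : ℂ) (c d : ℝ), u ≠ 0 ∧ c < d ∧ S = parallelStrip u c d

/-- `S` is an open infinite convex sector, of opening angle strictly between `0` and `π`. -/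
def IsSector (S : Set ℂ) : Prop :=
  ∃ (v u : ℂ) (α : ℝ), u ≠ 0 ∧ 0 < α ∧ α < Real.pi ∧ S = sector v u α

/-! Write `a` for the second coefficient and Ω for the image. Conformal radius is concave on a
convex domain: averaging `f` with a disk reparametrisation of itself gives a map into Ω, and
Schwarz-Pick compares derivatives. So the conformal radius lies below its tangent plane at the
origin, which at w is `1 + 2 Re(a w)`. Positivity of this plane on Ω is the inequality `|a w| < |1 +
a w|`, that is, `|a f*| < 1` (`confRadius_le`, `norm_mul_fStar_lt_one`).

The Schwarz lemma for `a f*` gives `|a| ≤ 1`. Koebe transforms carry this to every point, and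
Schwarz-Pick then yields Nehari's bound `|S_f| (1 - |z|²)² ≤ 2`. Along radii in hyperbolic arc
length the inverse square root of the speed of `f*` is therefore convex, with slope 0 at the start
because `f*` has no second coefficient. As `f*` is bounded, this function must eventually grow
linearly, so the speed is integrable, locally uniformly in the direction. This is the continuous
extension (`exists_tendsto_fStar`).

On the circle, `a f* = 1` means `f → ∞`; elsewhere `f` has a finite limit w, and `|a f*| = 1`
exactly when the tangent plane vanishes at w. The equality case of Schwarz-Pick turns contact with
the plane into symmetry of Ω: a zero of the plane on the boundary is a centre of dilations, so Ω is
a sector or a half-plane, and a direction to infinity in which the plane stays bounded is a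
direction of translations, so Ω is a strip or a half-plane (`dilation_of_affine_eq_zero`,
`exists_line_or_isBounded`).

Counting boundary points needs a uniqueness principle (`eq_of_isPreconnected_sublevel`): if two
circle points can be joined inside every set `|f* - β| < ε`, each diameter separating them ends at a
point where `f* = β`. That fills too much of the circle for a function omitting β inside. Convex
neighbourhoods of a point or of an end of Ω provide the connecting sets. -/

/-! ### Holomorphic inverses of injective maps -/

section InverseOfInjective

open Set

variable {f : ℂ → ℂ} {U : Set ℂ}

theorem nhds_le_map_nhds_of_injOn (hU : IsOpen U) (hf : DifferentiableOn ℂ f U)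
    (hinj : InjOn f U) {z : ℂ} (hz : z ∈ U) : 𝓝 (f z) ≤ map f (𝓝 z) := by
  refine ((hf.analyticAt (hU.mem_nhds hz)).eventually_constant_or_nhds_le_map_nhds).resolve_left ?_
  intro h
  have h1 : ∀ᶠ w in 𝓝[≠] z, f w = f z ∧ w ∈ U ∧ w ≠ z :=
    ((h.and (hU.mem_nhds hz)).filter_mono nhdsWithin_le_nhds).and self_mem_nhdsWithin
      |>.mono fun w hw => ⟨hw.1.1, hw.1.2, hw.2⟩
  obtain ⟨w, hw, hwU, hne⟩ := h1.exists
  exact hne (hinj hwU hz hw)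

theorem isOpen_image_of_injOn (hU : IsOpen U) (hf : DifferentiableOn ℂ f U)
    (hinj : InjOn f U) : IsOpen (f '' U) := by
  rw [isOpen_iff_mem_nhds]
  rintro _ ⟨z, hz, rfl⟩
  exact nhds_le_map_nhds_of_injOn hU hf hinj hz (image_mem_map (hU.mem_nhds hz))

theorem continuousAt_invFunOn (hU : IsOpen U) (hf : DifferentiableOn ℂ f U)
    (hinj : InjOn f U) {z : ℂ} (hz : z ∈ U) : ContinuousAt (Function.invFunOn f U) (f z) := by
  have hgz : Function.invFunOn f U (f z) = z := hinj.leftInvOn_invFunOn hz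
  rw [ContinuousAt, hgz]
  intro V hV
  have h1 : f '' (V ∩ U) ∈ 𝓝 (f z) :=
    nhds_le_map_nhds_of_injOn hU hf hinj hz (image_mem_map (inter_mem hV (hU.mem_nhds hz)))
  refine mem_map.2 (mem_of_superset h1 ?_)
  rintro _ ⟨x, ⟨hxV, hxU⟩, rfl⟩
  simpa [hinj.leftInvOn_invFunOn hxU] using hxV

theorem differentiableAt_invFunOn_of_deriv_ne_zero (hU : IsOpen U) (hf : DifferentiableOn ℂ f U)
    (hinj : InjOn f U) {z : ℂ} (hz : z ∈ U) (hd : deriv f z ≠ 0) :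
    DifferentiableAt ℂ (Function.invFunOn f U) (f z) := by
  have hgz : Function.invFunOn f U (f z) = z := hinj.leftInvOn_invFunOn hz
  have h := HasDerivAt.of_local_left_inverse (f := f) (f' := deriv f z)
    (g := Function.invFunOn f U) (a := f z) (continuousAt_invFunOn hU hf hinj hz)
    (by rw [hgz]; exact (hf.differentiableAt (hU.mem_nhds hz)).hasDerivAt) hd ?_
  · exact h.differentiableAt
  · filter_upwards [(isOpen_image_of_injOn hU hf hinj).mem_nhds (mem_image_of_mem f hz)] with w hw
    exact Function.invFunOn_eq hw

/-- Zeros of the derivative are isolated, since vanishing on a disk would make `f` constant there.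
The inverse is thus differentiable off isolated points, and being continuous it is differentiable at
them too. Nonvanishing of the derivative is a consequence, by the chain rule, not an input. -/
theorem differentiableOn_invFunOn (hU : IsOpen U) (hf : DifferentiableOn ℂ f U)
    (hinj : InjOn f U) : DifferentiableOn ℂ (Function.invFunOn f U) (f '' U) := by
  rintro _ ⟨z, hz, rfl⟩
  refine DifferentiableAt.differentiableWithinAt (AnalyticAt.differentiableAt ?_)
  have hgz : Function.invFunOn f U (f z) = z := hinj.leftInvOn_invFunOn hz
  have hc := continuousAt_invFunOn hU hf hinj hz
  refine Complex.analyticAt_of_differentiable_on_punctured_nhds_of_continuousAt ?_ hc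
  have hane : ∀ᶠ x in 𝓝[≠] z, deriv f x ≠ 0 := by
    refine (((hf.analyticAt (hU.mem_nhds hz)).deriv).eventually_eq_zero_or_eventually_ne_zero
      ).resolve_left fun h => ?_
    obtain ⟨r, hr, hball⟩ := Metric.eventually_nhds_iff_ball.1 (h.and (hU.mem_nhds hz))
    have hx : z + (r / 2 : ℝ) ∈ Metric.ball z r := by
      simp [abs_of_pos hr]; linarith
    have hz' : z ∈ Metric.ball z r := Metric.mem_ball_self hr
    have := (convex_ball z r).is_const_of_fderivWithin_eq_zero (𝕜 := ℂ) (f := f)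
      (fun y hy => (hf.differentiableAt (hU.mem_nhds (hball y hy).2)).differentiableWithinAt)
      (fun y hy => by
        rw [fderivWithin_of_isOpen Metric.isOpen_ball hy]
        ext
        simp [(hball y hy).1]) hz' hx
    have h2 := hinj hz (hball _ hx).2 this
    have h3 : ((r / 2 : ℝ) : ℂ) = 0 := by linear_combination -h2
    have h4 : r / 2 = 0 := by exact_mod_cast h3
    linarith
  have hg' : Tendsto (Function.invFunOn f U) (𝓝[≠] (f z)) (𝓝[≠] z) := by
    refine tendsto_nhdsWithin_iff.2 ⟨?_, ?_⟩
    · have := hc.tendsto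
      rw [hgz] at this
      exact this.mono_left nhdsWithin_le_nhds
    · filter_upwards [self_mem_nhdsWithin, nhdsWithin_le_nhds
        ((isOpen_image_of_injOn hU hf hinj).mem_nhds (mem_image_of_mem f hz))] with w hw hwU h
      apply hw
      have : Function.invFunOn f U w = z := h
      rw [mem_singleton_iff, ← this, Function.invFunOn_eq hwU]
  filter_upwards [hg'.eventually hane, nhdsWithin_le_nhds
        ((isOpen_image_of_injOn hU hf hinj).mem_nhds (mem_image_of_mem f hz))] with w hw hwU
  obtain ⟨x, hx, rfl⟩ := hwU
  rw [hinj.leftInvOn_invFunOn hx] at hw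
  exact differentiableAt_invFunOn_of_deriv_ne_zero hU hf hinj hx hw

theorem deriv_ne_zero_of_injOn (hU : IsOpen U) (hf : DifferentiableOn ℂ f U)
    (hinj : InjOn f U) {z : ℂ} (hz : z ∈ U) : deriv f z ≠ 0 := by
  intro h0
  have h1 := ((differentiableOn_invFunOn hU hf hinj).differentiableAt
    ((isOpen_image_of_injOn hU hf hinj).mem_nhds (mem_image_of_mem f hz))).hasDerivAt
  have h2 := h1.comp z (hf.differentiableAt (hU.mem_nhds hz)).hasDerivAt
  have h3 : HasDerivAt (Function.invFunOn f U ∘ f) 1 z := by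
    refine (hasDerivAt_id z).congr_of_eventuallyEq ?_
    filter_upwards [hU.mem_nhds hz] with x hx
    exact hinj.leftInvOn_invFunOn hx
  have h4 := h2.unique h3
  simp [h0] at h4

end InverseOfInjective

/-! ### Disk automorphisms and the Schwarz-Pick inequality -/

section SchwarzPick

open Metric Set

/-- The disk automorphism sending `0` to `p`. -/
noncomputable def diskShift (p z : ℂ) : ℂ := (z + p) / (1 + (starRingEnd ℂ) p * z)

theorem one_add_conj_mul_ne_zero {p z : ℂ} (hp : ‖p‖ < 1) (hz : ‖z‖ ≤ 1) :
    1 + (starRingEnd ℂ) p * z ≠ 0 := by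
  intro h
  have h1 : (starRingEnd ℂ) p * z = -1 := by linear_combination h
  have h2 : ‖p‖ * ‖z‖ = 1 := by
    have := congrArg norm h1
    simpa using this
  nlinarith [norm_nonneg p, norm_nonneg z]

theorem sq_norm_one_add_conj_mul_sub (p z : ℂ) :
    ‖1 + (starRingEnd ℂ) p * z‖ ^ 2 - ‖z + p‖ ^ 2 = (1 - ‖p‖ ^ 2) * (1 - ‖z‖ ^ 2) := by
  simp only [Complex.sq_norm, Complex.normSq_apply]
  simp
  ring

theorem norm_diskShift_lt_one {p z : ℂ} (hp : ‖p‖ < 1) (hz : ‖z‖ < 1) : ‖diskShift p z‖ < 1 := by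
  have h1 := one_add_conj_mul_ne_zero hp hz.le
  rw [diskShift, norm_div, div_lt_one (norm_pos_iff.2 h1)]
  have h := sq_norm_one_add_conj_mul_sub p z
  have h2 : 0 < (1 - ‖p‖ ^ 2) * (1 - ‖z‖ ^ 2) := by
    apply mul_pos <;> nlinarith [norm_nonneg p, norm_nonneg z]
  exact lt_of_pow_lt_pow_left₀ 2 (norm_nonneg _) (by linarith)

theorem mapsTo_diskShift {p : ℂ} (hp : ‖p‖ < 1) :
    MapsTo (diskShift p) (ball 0 1) (ball 0 1) := fun z hz => by
  rw [mem_ball_zero_iff] at *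
  exact norm_diskShift_lt_one hp hz

@[simp] theorem diskShift_zero (p : ℂ) : diskShift p 0 = p := by simp [diskShift]

theorem diskShift_neg_self (p : ℂ) : diskShift (-p) p = 0 := by simp [diskShift]

theorem diskShift_diskShift_neg {p z : ℂ} (hp : ‖p‖ < 1) (hz : ‖z‖ < 1) :
    diskShift p (diskShift (-p) z) = z := by
  have h1 : 1 + (starRingEnd ℂ) (-p) * z ≠ 0 :=
    one_add_conj_mul_ne_zero (by simpa using hp) hz.le
  have h2 := one_add_conj_mul_ne_zero hp
    (norm_diskShift_lt_one (p := -p) (by simpa using hp) hz).le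
  have h3 : 1 - (starRingEnd ℂ) p * p ≠ 0 := by
    have := one_add_conj_mul_ne_zero hp (z := -p) (by simpa using hp.le)
    simpa [sub_eq_add_neg] using this
  have h1' : 1 - (starRingEnd ℂ) p * z ≠ 0 := by simpa [sub_eq_add_neg] using h1
  rw [diskShift, div_eq_iff h2]
  simp only [diskShift, map_neg, neg_mul, ← sub_eq_add_neg]
  generalize (starRingEnd ℂ) p = q at *
  have h1'' : 1 - z * q ≠ 0 := by rwa [mul_comm]
  field_simp
  ring

theorem surjOn_diskShift {p : ℂ} (hp : ‖p‖ < 1) :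
    SurjOn (diskShift p) (ball 0 1) (ball 0 1) := fun z hz => by
  rw [mem_ball_zero_iff] at hz
  exact ⟨diskShift (-p) z, mapsTo_diskShift (by simpa using hp) (by simpa using hz),
    diskShift_diskShift_neg hp hz⟩

theorem hasDerivAt_diskShift {p z : ℂ} (hp : ‖p‖ < 1) (hz : ‖z‖ < 1) :
    HasDerivAt (diskShift p) ((1 - (‖p‖ ^ 2 : ℝ)) / (1 + (starRingEnd ℂ) p * z) ^ 2) z := by
  have h1 := one_add_conj_mul_ne_zero hp hz.le
  have h2 := ((hasDerivAt_id z).add_const p).div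
    (((hasDerivAt_id z).const_mul ((starRingEnd ℂ) p)).const_add 1) h1
  refine h2.congr_deriv ?_
  have h3 : ((‖p‖ ^ 2 : ℝ) : ℂ) = (starRingEnd ℂ) p * p := by
    rw [mul_comm, Complex.mul_conj, Complex.normSq_eq_norm_sq]
  rw [h3]
  congr 1
  simp
  ring

theorem hasDerivAt_diskShift_zero {p : ℂ} (hp : ‖p‖ < 1) :
    HasDerivAt (diskShift p) (1 - (‖p‖ ^ 2 : ℝ)) 0 := by
  simpa using hasDerivAt_diskShift hp (z := 0) (by simp)

theorem differentiableOn_diskShift {p : ℂ} (hp : ‖p‖ < 1) :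
    DifferentiableOn ℂ (diskShift p) (ball 0 1) := fun z hz =>
  (hasDerivAt_diskShift hp (by simpa using hz)).differentiableAt.differentiableWithinAt

variable {ω : ℂ → ℂ}

/-- The Schwarz-Pick inequality at the origin, together with its equality case. -/
theorem schwarzPick_zero (hd : DifferentiableOn ℂ ω (ball 0 1))
    (hm : MapsTo ω (ball 0 1) (ball 0 1)) :
    ‖deriv ω 0‖ ≤ 1 - ‖ω 0‖ ^ 2 ∧
      (1 - ‖ω 0‖ ^ 2 ≤ ‖deriv ω 0‖ → SurjOn ω (ball 0 1) (ball 0 1)) := by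
  have h0 : (0 : ℂ) ∈ ball (0 : ℂ) 1 := by simp
  set p := ω 0 with hp
  have hp1 : ‖p‖ < 1 := by simpa using hm h0
  have hnp : ‖-p‖ < 1 := by simpa using hp1
  -- Moving `ω 0` to the origin reduces to the Schwarz lemma; in the equality case `σ` is a
  -- rotation, and its surjectivity passes back to `ω`.
  set σ : ℂ → ℂ := diskShift (-p) ∘ ω with hσ
  have hσd : DifferentiableOn ℂ σ (ball 0 1) := (differentiableOn_diskShift hnp).comp hd hm
  have hσm : MapsTo σ (ball 0 1) (ball 0 1) := (mapsTo_diskShift hnp).comp hm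
  have hσ0 : σ 0 = 0 := by simp [hσ, ← hp, diskShift_neg_self]
  have hσm' : MapsTo σ (ball 0 1) (closedBall (σ 0) 1) := by
    rw [hσ0]; exact hσm.mono_right ball_subset_closedBall
  have hpos : 0 < 1 - ‖p‖ ^ 2 := by nlinarith [norm_nonneg p]
  have hderiv : deriv σ 0 = (1 / (1 - (‖p‖ ^ 2 : ℝ))) * deriv ω 0 := by
    have h1 := (hasDerivAt_diskShift hnp hp1).comp (0 : ℂ)
      (hd.differentiableAt (isOpen_ball.mem_nhds h0)).hasDerivAt
    rw [show deriv σ 0 = _ from h1.deriv]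
    have h3 : (starRingEnd ℂ) p * p = ((‖p‖ ^ 2 : ℝ) : ℂ) := by
      rw [mul_comm, Complex.mul_conj, Complex.normSq_eq_norm_sq]
    have h4 : (1 - ((‖p‖ ^ 2 : ℝ) : ℂ)) ≠ 0 := by
      exact_mod_cast hpos.ne'
    rw [map_neg, neg_mul, h3, norm_neg, ← sub_eq_add_neg]
    field_simp
  have hnorm : ‖deriv σ 0‖ = ‖deriv ω 0‖ / (1 - ‖p‖ ^ 2) := by
    rw [hderiv, norm_mul, norm_div, norm_one]
    have : ‖(1 - ((‖p‖ ^ 2 : ℝ) : ℂ))‖ = 1 - ‖p‖ ^ 2 := by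
      rw [show (1 - ((‖p‖ ^ 2 : ℝ) : ℂ)) = ((1 - ‖p‖ ^ 2 : ℝ) : ℂ) by push_cast; ring,
        Complex.norm_of_nonneg hpos.le]
    rw [this]; ring
  have hle := Complex.norm_deriv_le_one_of_mapsTo_ball hσd hσm' one_pos
  refine ⟨by rwa [hnorm, div_le_one hpos] at hle, fun hge => ?_⟩
  have h1 : ‖deriv σ 0‖ = 1 := le_antisymm hle (by rwa [hnorm, le_div_iff₀ hpos, one_mul])
  have haff := Complex.affine_of_mapsTo_ball_of_norm_dslope_eq_div hσd hσm' h0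
    (by rw [dslope_same, h1]; norm_num)
  have hne : deriv σ 0 ≠ 0 := by
    intro h; rw [h] at h1; simp at h1
  intro y hy
  set x := diskShift (-p) y with hx
  have hxb : x ∈ ball (0 : ℂ) 1 := mapsTo_diskShift hnp hy
  have hxb' : x / deriv σ 0 ∈ ball (0 : ℂ) 1 := by
    rw [mem_ball_zero_iff, norm_div, h1, div_one]; simpa using hxb
  refine ⟨x / deriv σ 0, hxb', ?_⟩
  have h2 := haff hxb'
  simp only [hσ0, dslope_same, sub_zero, smul_eq_mul, zero_add] at h2
  rw [div_mul_cancel₀ _ hne] at h2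
  have h3 := congrArg (diskShift p) h2
  rw [hσ, Function.comp_apply, diskShift_diskShift_neg hp1 (by simpa using hm hxb'), hx,
    diskShift_diskShift_neg hp1 (by simpa using hy)] at h3
  exact h3

/-- The Schwarz-Pick inequality at an arbitrary point, for maps into the closed disk. -/
theorem schwarzPick_of_mapsTo_closedBall (hd : DifferentiableOn ℂ ω (ball 0 1))
    (hm : MapsTo ω (ball 0 1) (closedBall 0 1)) {z : ℂ} (hz : ‖z‖ < 1) :
    ‖deriv ω z‖ * (1 - ‖z‖ ^ 2) ≤ 1 - ‖ω z‖ ^ 2 := by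
  -- The factor `c < 1` pushes the values into the open disk, where the version at the origin
  -- applies; `c → 1` at the end.
  have key : ∀ c : ℝ, 0 < c → c < 1 →
      c * (‖deriv ω z‖ * (1 - ‖z‖ ^ 2)) ≤ 1 - (c * ‖ω z‖) ^ 2 := by
    intro c hc hc1
    set τ : ℂ → ℂ := fun x => (c : ℂ) * ω (diskShift z x) with hτ
    have hτd : DifferentiableOn ℂ τ (ball 0 1) :=
      (hd.comp (differentiableOn_diskShift hz) (mapsTo_diskShift hz)).const_mul _
    have hτm : MapsTo τ (ball 0 1) (ball 0 1) := by
      intro x hx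
      have := hm (mapsTo_diskShift hz hx)
      rw [mem_closedBall_zero_iff] at this
      rw [mem_ball_zero_iff, hτ, norm_mul, Complex.norm_of_nonneg hc.le]
      nlinarith [norm_nonneg (ω (diskShift z x))]
    have h1 := (schwarzPick_zero hτd hτm).1
    have hz' : diskShift z 0 ∈ ball (0 : ℂ) 1 := by simpa using hz
    have h2 : HasDerivAt τ (c * (deriv ω z * (1 - (‖z‖ ^ 2 : ℝ)))) 0 := by
      have := ((hd.differentiableAt (isOpen_ball.mem_nhds hz')).hasDerivAt.comp (0 : ℂ)
        (hasDerivAt_diskShift_zero hz)).const_mul (c : ℂ)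
      simpa using this
    have hpos : 0 < 1 - ‖z‖ ^ 2 := by nlinarith [norm_nonneg z]
    have h3 : ‖(1 - ((‖z‖ ^ 2 : ℝ) : ℂ))‖ = 1 - ‖z‖ ^ 2 := by
      rw [show (1 - ((‖z‖ ^ 2 : ℝ) : ℂ)) = ((1 - ‖z‖ ^ 2 : ℝ) : ℂ) by push_cast; ring,
        Complex.norm_of_nonneg hpos.le]
    rw [h2.deriv, norm_mul, norm_mul, h3, Complex.norm_of_nonneg hc.le] at h1
    simpa [hτ, abs_of_pos hc] using h1
  have hl : Tendsto (fun c : ℝ => c * (‖deriv ω z‖ * (1 - ‖z‖ ^ 2))) (𝓝[<] 1)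
      (𝓝 (1 * (‖deriv ω z‖ * (1 - ‖z‖ ^ 2)))) :=
    (Continuous.tendsto (by fun_prop) 1).mono_left nhdsWithin_le_nhds
  have hr : Tendsto (fun c : ℝ => 1 - (c * ‖ω z‖) ^ 2) (𝓝[<] 1)
      (𝓝 (1 - (1 * ‖ω z‖) ^ 2)) :=
    (Continuous.tendsto (by fun_prop) 1).mono_left nhdsWithin_le_nhds
  have := le_of_tendsto_of_tendsto hl hr (by
    filter_upwards [Ioo_mem_nhdsLT (zero_lt_one (α := ℝ))] with c hc
    exact key c hc.1 hc.2)
  simpa using this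

end SchwarzPick

/-! ### Conformal radius and its tangent plane at the origin -/

theorem nonneg_of_hasDerivAt_of_eventually_nonneg {D : ℝ → ℝ} {d : ℝ} (hD : HasDerivAt D d 0)
    (h0 : D 0 = 0) (hpos : ∀ᶠ t in 𝓝[>] 0, 0 ≤ D t) : 0 ≤ d := by
  refine ge_of_tendsto hD.tendsto_slope_zero_right ?_
  filter_upwards [hpos, self_mem_nhdsWithin] with t ht ht0
  have : 0 < t := ht0
  simp only [zero_add, h0, sub_zero, smul_eq_mul]
  positivity

/-- The conformal radius of the image of the unit disk, as a function on the disk. -/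
noncomputable def confRadius (f : ℂ → ℂ) (z : ℂ) : ℝ := ‖deriv f z‖ * (1 - ‖z‖ ^ 2)

namespace IsConvexMapping

open Metric Set

variable {f : ℂ → ℂ}

theorem isOpen_image (hf : IsConvexMapping f) : IsOpen (f '' ball 0 1) :=
  isOpen_image_of_injOn isOpen_ball hf.differentiableOn hf.injOn

theorem differentiableAt (hf : IsConvexMapping f) {z : ℂ} (hz : ‖z‖ < 1) :
    DifferentiableAt ℂ f z :=
  hf.differentiableOn.differentiableAt (isOpen_ball.mem_nhds (by simpa using hz))

theorem analyticAt (hf : IsConvexMapping f) {z : ℂ} (hz : ‖z‖ < 1) : AnalyticAt ℂ f z :=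
  hf.differentiableOn.analyticAt (isOpen_ball.mem_nhds (by simpa using hz))

theorem deriv_ne_zero (hf : IsConvexMapping f) {z : ℂ} (hz : ‖z‖ < 1) : deriv f z ≠ 0 :=
  deriv_ne_zero_of_injOn isOpen_ball hf.differentiableOn hf.injOn (by simpa using hz)

theorem mem_image (f : ℂ → ℂ) {z : ℂ} (hz : ‖z‖ < 1) : f z ∈ f '' ball 0 1 :=
  mem_image_of_mem f (by simpa using hz)

theorem zero_mem_image (hf : IsConvexMapping f) : (0 : ℂ) ∈ f '' ball 0 1 :=
  ⟨0, by simp, hf.map_zero⟩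

theorem confRadius_pos (hf : IsConvexMapping f) {z : ℂ} (hz : ‖z‖ < 1) : 0 < confRadius f z := by
  have := norm_pos_iff.2 (hf.deriv_ne_zero hz)
  have : 0 < 1 - ‖z‖ ^ 2 := by nlinarith [norm_nonneg z]
  unfold confRadius
  positivity

/-- The Schwarz-Pick inequality for holomorphic maps of the disk into the image of `f`. -/
theorem norm_deriv_le_confRadius (hf : IsConvexMapping f) {h : ℂ → ℂ} {z : ℂ}
    (hd : DifferentiableOn ℂ h (ball 0 1))
    (hm : MapsTo h (ball 0 1) (f '' ball 0 1)) (hz : ‖z‖ < 1) (h0 : h 0 = f z) :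
    ‖deriv h 0‖ ≤ confRadius f z ∧
      (confRadius f z ≤ ‖deriv h 0‖ → SurjOn h (ball 0 1) (f '' ball 0 1)) := by
  set g := Function.invFunOn f (ball 0 1)
  have hgd := differentiableOn_invFunOn isOpen_ball hf.differentiableOn hf.injOn
  set ω := g ∘ h with hω
  have hωd : DifferentiableOn ℂ ω (ball 0 1) := hgd.comp hd hm
  have hωm : MapsTo ω (ball 0 1) (ball 0 1) := fun x hx => Function.invFunOn_mem (hm hx)
  have hfω : EqOn (f ∘ ω) h (ball 0 1) := fun x hx => Function.invFunOn_eq (hm hx)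
  have hb0 : (0 : ℂ) ∈ ball (0 : ℂ) 1 := by simp
  have hω0 : ω 0 = z := by
    simp only [hω, Function.comp_apply, h0]
    exact hf.injOn.leftInvOn_invFunOn (by simpa using hz)
  have hder : deriv h 0 = deriv f z * deriv ω 0 := by
    have h1 : deriv h 0 = deriv (f ∘ ω) 0 :=
      (hfω.eventuallyEq_of_mem (isOpen_ball.mem_nhds hb0)).deriv_eq.symm
    rw [h1, deriv_comp, hω0]
    · rw [hω0]; exact hf.differentiableAt hz
    · exact hωd.differentiableAt (isOpen_ball.mem_nhds hb0)
  have hpos := norm_pos_iff.2 (hf.deriv_ne_zero hz)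
  obtain ⟨h1, h2⟩ := schwarzPick_zero hωd hωm
  rw [hω0] at h1 h2
  rw [hder, norm_mul, confRadius, mul_le_mul_iff_right₀ hpos, mul_le_mul_iff_right₀ hpos]
  refine ⟨h1, fun h3 => ?_⟩
  rintro _ ⟨y, hy, rfl⟩
  obtain ⟨x, hx, hxy⟩ := h2 h3 hy
  exact ⟨x, hx, by rw [← hfω hx, Function.comp_apply, hxy]⟩

theorem secondCoeff_eq (f : ℂ → ℂ) : deriv (deriv f) 0 = 2 * secondCoeff f := by
  rw [secondCoeff, iteratedDeriv_succ, iteratedDeriv_one]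
  ring

/-- The tangent plane of the conformal radius at the origin lies above its graph. -/
theorem confRadius_le (hf : IsConvexMapping f) {z : ℂ} (hz : ‖z‖ < 1) :
    confRadius f z ≤ 1 + 2 * (secondCoeff f * f z).re := by
  set a := secondCoeff f with ha
  set R := confRadius f z with hR
  set w := f z with hw
  set g := Function.invFunOn f (ball 0 1) with hg
  have hb0 : (0 : ℂ) ∈ ball (0 : ℂ) 1 := by simp
  have hg0 : g 0 = 0 := by
    have := hf.injOn.leftInvOn_invFunOn hb0
    rwa [hf.map_zero] at this
  have hgd := differentiableOn_invFunOn isOpen_ball hf.differentiableOn hf.injOn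
  have htw : ∀ t : ℝ, 0 ≤ t → t ≤ 1 → (t * w : ℂ) ∈ f '' ball 0 1 := by
    intro t h0 h1
    have := hf.convex_image hf.zero_mem_image (mem_image f hz) (sub_nonneg.2 h1) h0 (by ring)
    simpa using this
  -- The rotation `c` aligns the derivative at `z` with that at 0, so that the two add without
  -- cancellation in the average below.
  obtain ⟨c, hc, hcf⟩ : ∃ c : ℂ, ‖c‖ = 1 ∧ c * deriv f z = ‖deriv f z‖ := by
    refine ⟨(starRingEnd ℂ) (deriv f z) / ‖deriv f z‖, ?_, ?_⟩
    · have := norm_ne_zero_iff.2 (hf.deriv_ne_zero hz)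
      simp [this]
    · have h2 : (‖deriv f z‖ : ℂ) ≠ 0 := by exact_mod_cast norm_ne_zero_iff.2 (hf.deriv_ne_zero hz)
      rw [div_mul_eq_mul_div, mul_comm, Complex.mul_conj, Complex.normSq_eq_norm_sq]
      field_simp
      push_cast
      ring
  have hcm : MapsTo (fun x => diskShift z (c * x)) (ball 0 1) (ball 0 1) := fun x hx =>
    mapsTo_diskShift hz (by simpa [hc] using hx)
  -- Concavity along the segment from 0 to `w`: the average `h` stays in the convex image, has `h 0
  -- = t w`, and its derivative at 0 is the left-hand side.
  have key : ∀ t : ℝ, 0 ≤ t → t ≤ 1 → 1 - t + t * R ≤ confRadius f (g (t * w)) := by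
    intro t h0 h1
    set h : ℂ → ℂ := fun x => (1 - t) * f x + t * f (diskShift z (c * x)) with hh
    have hcd : DifferentiableOn ℂ (fun x => diskShift z (c * x)) (ball 0 1) :=
      (differentiableOn_diskShift hz).comp (by fun_prop) fun x hx => by simpa [hc] using hx
    have hd : DifferentiableOn ℂ h (ball 0 1) :=
      (hf.differentiableOn.const_mul _).add ((hf.differentiableOn.comp hcd hcm).const_mul _)
    have hm : MapsTo h (ball 0 1) (f '' ball 0 1) := by
      intro x hx
      have := hf.convex_image (mem_image_of_mem f hx) (mem_image_of_mem f (hcm hx))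
        (sub_nonneg.2 h1) h0 (by ring)
      simpa [hh] using this
    have hgm : ‖g (t * w)‖ < 1 := by
      simpa using Function.invFunOn_mem (htw t h0 h1)
    have h3 := (hf.norm_deriv_le_confRadius hd hm hgm
      (by rw [Function.invFunOn_eq (htw t h0 h1)]; simp [hh, hf.map_zero, hw])).1
    have h4 : HasDerivAt h ((1 - t) * 1 + t * (deriv f z * ((1 - (‖z‖ ^ 2 : ℝ)) * c))) 0 := by
      have e1 := (hf.differentiableAt (z := 0) (by simp)).hasDerivAt
      rw [hf.deriv_zero] at e1
      have e2 : HasDerivAt (fun x => diskShift z (c * x)) ((1 - (‖z‖ ^ 2 : ℝ)) * c) 0 := by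
        have := hasDerivAt_diskShift_zero hz
        have e4 : HasDerivAt (fun x : ℂ => c * x) c 0 := by
          simpa using (hasDerivAt_id (0 : ℂ)).const_mul c
        rw [show (0 : ℂ) = c * 0 by simp] at this
        exact this.comp (0 : ℂ) e4
      have e3 := (hf.differentiableAt hz).hasDerivAt
      rw [show z = diskShift z (c * 0) by simp] at e3
      have := (e1.const_mul ((1 : ℂ) - t)).add ((e3.comp (0 : ℂ) e2).const_mul (t : ℂ))
      exact this.congr_deriv (by simp)
    rw [h4.deriv] at h3
    have h5 : ((1 - t) * 1 + t * (deriv f z * ((1 - (‖z‖ ^ 2 : ℝ)) * c)) : ℂ)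
        = ((1 - t + t * R : ℝ) : ℂ) := by
      rw [hR, confRadius]
      push_cast
      linear_combination (t * (1 - (‖z‖ : ℂ) ^ 2)) * hcf
    have hRpos := hf.confRadius_pos hz
    rw [h5, Complex.norm_of_nonneg (by nlinarith)] at h3
    exact h3
  have hγ : HasDerivAt (fun t : ℝ => g (t * w)) w 0 := by
    have e0 := (hgd.differentiableAt (hf.isOpen_image.mem_nhds hf.zero_mem_image)).hasDerivAt
    have e1 : HasDerivAt f 1 (g 0) := by
      rw [hg0, ← hf.deriv_zero]
      exact (hf.differentiableAt (by simp)).hasDerivAt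
    have e2 : HasDerivAt g 1⁻¹ 0 := by
      refine HasDerivAt.of_local_left_inverse e0.continuousAt e1 one_ne_zero ?_
      filter_upwards [hf.isOpen_image.mem_nhds hf.zero_mem_image] with y hy
      exact Function.invFunOn_eq hy
    have e3 : HasDerivAt (fun t : ℝ => (t * w : ℂ)) w 0 := by
      simpa using (Complex.ofRealCLM.hasDerivAt (x := (0 : ℝ))).mul_const w
    have e2' : HasDerivAt g 1⁻¹ (((0 : ℝ) : ℂ) * w) := by simpa using e2
    have e4 := HasDerivAt.comp (0 : ℝ) e2' e3
    exact e4.congr_deriv (by simp)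
  have hγ0 : g (((0 : ℝ) : ℂ) * w) = 0 := by simp [hg0]
  have hδ : HasDerivAt (fun t : ℝ => deriv f (g (t * w))) (2 * a * w) 0 := by
    have e1 : HasDerivAt (deriv f) (2 * a) (g (((0 : ℝ) : ℂ) * w)) := by
      rw [hγ0, ha, ← secondCoeff_eq]
      exact (hf.analyticAt (by simp)).deriv.differentiableAt.hasDerivAt
    exact HasDerivAt.comp (0 : ℝ) e1 hγ
  -- Squaring makes both sides differentiable. `D` vanishes at 0 and is nonnegative to the right of
  -- it, so its derivative `4 Re(a w) - 2 (R - 1)` is nonnegative.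
  set D : ℝ → ℝ := fun t =>
    ‖deriv f (g (t * w))‖ ^ 2 * (1 - ‖g (t * w)‖ ^ 2) ^ 2 - (1 - t + t * R) ^ 2 with hD
  have hDd : HasDerivAt D (2 * (2 * a * w).re - 2 * (R - 1)) 0 := by
    have e1 := hδ.norm_sq
    have e2 := hγ.norm_sq
    have e3 : HasDerivAt (fun t : ℝ => 1 - t + t * R) (R - 1) 0 := by
      have := ((hasDerivAt_id (0 : ℝ)).const_sub 1).add ((hasDerivAt_id (0 : ℝ)).mul_const R)
      refine this.congr_deriv (by ring)
    have e4 := (e1.mul ((e2.const_sub 1).pow 2)).sub (e3.pow 2)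
    refine e4.congr_deriv ?_
    simp [hg0, hf.deriv_zero]
  have hnn := nonneg_of_hasDerivAt_of_eventually_nonneg hDd
    (by simp [hD, hf.deriv_zero, hg0]) (by
      filter_upwards [Ioo_mem_nhdsGT (zero_lt_one (α := ℝ))] with t ht
      have h1 := key t ht.1.le ht.2.le
      have hRpos := hf.confRadius_pos hz
      have h0 : 0 ≤ 1 - t + t * R := by
        have := ht.2; have := ht.1; nlinarith
      have h2 := pow_le_pow_left₀ h0 h1 2
      rw [confRadius, mul_pow] at h2
      simp only [hD]
      linarith)
  have e : (2 * a * w).re = 2 * (a * w).re := by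
    rw [mul_assoc]; simp
  rw [e] at hnn
  linarith

theorem one_add_two_mul_re_pos (hf : IsConvexMapping f) {z : ℂ} (hz : ‖z‖ < 1) :
    0 < 1 + 2 * (secondCoeff f * f z).re :=
  (hf.confRadius_pos hz).trans_le (hf.confRadius_le hz)

end IsConvexMapping

/-! ### The Moebius shift inside the disk and the coefficient bound -/

/-- With `x = a f(z)` this turns positivity of the tangent plane into both the nonvanishing of `1 +
a f` and the bound on `a f*`. -/
theorem norm_sq_one_add_sub_norm_sq (x : ℂ) : ‖1 + x‖ ^ 2 - ‖x‖ ^ 2 = 1 + 2 * x.re := by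
  simp only [Complex.sq_norm, Complex.normSq_apply]
  simp
  ring

namespace IsConvexMapping

open Metric Set

variable {f : ℂ → ℂ}

theorem one_add_ne_zero (hf : IsConvexMapping f) {z : ℂ} (hz : ‖z‖ < 1) :
    1 + secondCoeff f * f z ≠ 0 := by
  intro h
  have h1 := norm_sq_one_add_sub_norm_sq (secondCoeff f * f z)
  have h2 := hf.one_add_two_mul_re_pos hz
  rw [h, norm_zero] at h1
  nlinarith [norm_nonneg (secondCoeff f * f z)]

theorem norm_mul_fStar_lt_one (hf : IsConvexMapping f) {z : ℂ} (hz : ‖z‖ < 1) :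
    ‖secondCoeff f * fStar f z‖ < 1 := by
  have h1 := norm_sq_one_add_sub_norm_sq (secondCoeff f * f z)
  have h2 := hf.one_add_two_mul_re_pos hz
  rw [fStar, ← mul_div_assoc, norm_div, div_lt_one (norm_pos_iff.2 (hf.one_add_ne_zero hz))]
  exact lt_of_pow_lt_pow_left₀ 2 (norm_nonneg _) (by linarith)

theorem hasDerivAt_fStar (hf : IsConvexMapping f) {z : ℂ} (hz : ‖z‖ < 1) :
    HasDerivAt (fStar f) (deriv f z / (1 + secondCoeff f * f z) ^ 2) z := by
  have h1 := (hf.differentiableAt hz).hasDerivAt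
  refine (h1.div ((h1.const_mul (secondCoeff f)).const_add 1)
    (hf.one_add_ne_zero hz)).congr_deriv ?_
  congr 1
  ring

/-- Schwarz lemma for `a f*`, which fixes 0 and has derivative `a` there. -/
theorem norm_secondCoeff_le_one (hf : IsConvexMapping f) : ‖secondCoeff f‖ ≤ 1 := by
  set h : ℂ → ℂ := fun z => secondCoeff f * fStar f z with hh
  have hd : DifferentiableOn ℂ h (ball 0 1) := fun z hz =>
    ((hf.hasDerivAt_fStar (by simpa using hz)).const_mul _
      ).differentiableAt.differentiableWithinAt
  have h0 : h 0 = 0 := by simp [hh, fStar, hf.map_zero]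
  have hm : MapsTo h (ball 0 1) (closedBall (h 0) 1) := fun z hz => by
    rw [h0, mem_closedBall_zero_iff]
    exact (hf.norm_mul_fStar_lt_one (by simpa using hz)).le
  have h1 := Complex.norm_deriv_le_one_of_mapsTo_ball hd hm one_pos
  rw [((hf.hasDerivAt_fStar (z := 0) (by simp)).const_mul _).deriv] at h1
  simpa [hf.map_zero, hf.deriv_zero] using h1

/-- The Koebe transform of a convex mapping is a convex mapping. -/
theorem koebe (hf : IsConvexMapping f) {p : ℂ} (hp : ‖p‖ < 1) :
    IsConvexMapping (fun x => (f (diskShift p x) - f p) / (deriv f p * (1 - (‖p‖ ^ 2 : ℝ)))) := by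
  have hc : (1 - (‖p‖ ^ 2 : ℝ) : ℂ) ≠ 0 := by
    have : 1 - ‖p‖ ^ 2 ≠ 0 := by nlinarith [norm_nonneg p]
    exact_mod_cast this
  have hk := mul_ne_zero (hf.deriv_ne_zero hp) hc
  set k := deriv f p * (1 - (‖p‖ ^ 2 : ℝ) : ℂ) with hkdef
  refine ⟨?_, ?_, by simp, ?_, ?_⟩
  · exact (((hf.differentiableOn.comp (differentiableOn_diskShift hp)
      (mapsTo_diskShift hp)).sub_const _).div_const _)
  · intro x hx y hy hxy
    have h1 : f (diskShift p x) = f (diskShift p y) := by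
      simpa [div_left_inj' hk] using hxy
    have h2 := hf.injOn (mapsTo_diskShift hp hx) (mapsTo_diskShift hp hy) h1
    have hp' : ‖-p‖ < 1 := by simpa using hp
    have h3 := congrArg (diskShift (-p)) h2
    have e : ∀ x ∈ ball (0 : ℂ) 1, diskShift (-p) (diskShift p x) = x := fun x hx => by
      have := diskShift_diskShift_neg hp' (z := x) (by simpa using hx)
      rwa [neg_neg] at this
    rwa [e x hx, e y hy] at h3
  · have e3 := (hf.differentiableAt hp).hasDerivAt
    have e2 := hasDerivAt_diskShift_zero hp
    rw [← diskShift_zero p] at e3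
    have := ((e3.comp (0 : ℂ) e2).sub_const (f p)).div_const k
    refine this.deriv.trans ?_
    simp only [diskShift_zero]
    exact div_self hk
  · have e : (fun x => (f (diskShift p x) - f p) / k) '' ball 0 1
        = (fun w => k⁻¹ • (w + -f p)) '' (f '' ball 0 1) := by
      ext w
      constructor
      · rintro ⟨x, hx, rfl⟩
        refine ⟨_, mem_image_of_mem f (mapsTo_diskShift hp hx), ?_⟩
        simp only [smul_eq_mul]
        field_simp
        ring
      · rintro ⟨_, ⟨y, hy, rfl⟩, rfl⟩
        obtain ⟨x, hx, rfl⟩ := surjOn_diskShift hp hy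
        refine ⟨x, hx, ?_⟩
        simp only [smul_eq_mul]
        field_simp
        ring
    rw [e]
    have h1 : Convex ℝ ((fun w => w + -f p) '' (f '' ball 0 1)) := by
      have := hf.convex_image.translate (-f p)
      simpa [add_comm] using this
    have h2 := h1.is_linear_image (f := fun w => k⁻¹ • w)
      ⟨fun x y => smul_add _ _ _, fun c x => smul_comm _ _ _⟩
    rwa [image_image] at h2

/-! ### From the coefficient bound to Nehari's bound -/

/-- The quantity inside the norm is the second coefficient of the Koebe transform at `p`. -/
theorem norm_koebe_secondCoeff_le_one (hf : IsConvexMapping f) {p : ℂ} (hp : ‖p‖ < 1) :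
    ‖deriv (deriv f) p * (1 - (‖p‖ ^ 2 : ℝ)) / (2 * deriv f p) - (starRingEnd ℂ) p‖ ≤ 1 := by
  have h := (hf.koebe hp).norm_secondCoeff_le_one
  have hc : (1 - (‖p‖ ^ 2 : ℝ) : ℂ) ≠ 0 := by
    have : 1 - ‖p‖ ^ 2 ≠ 0 := by nlinarith [norm_nonneg p]
    exact_mod_cast this
  have hk := hf.deriv_ne_zero hp
  set c := (1 - (‖p‖ ^ 2 : ℝ) : ℂ) with hcdef
  set F : ℂ → ℂ := fun x => (f (diskShift p x) - f p) / (deriv f p * c) with hF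
  have hF' : deriv F =ᶠ[𝓝 0] fun x =>
      deriv f (diskShift p x) * (c / (1 + (starRingEnd ℂ) p * x) ^ 2) / (deriv f p * c) := by
    filter_upwards [isOpen_ball.mem_nhds (show (0 : ℂ) ∈ ball (0 : ℂ) 1 by simp)] with x hx
    have hx1 : ‖x‖ < 1 := by simpa using hx
    have e3 := (hf.differentiableAt (norm_diskShift_lt_one hp hx1)).hasDerivAt
    have := ((e3.comp x (hasDerivAt_diskShift hp hx1)).sub_const (f p)).div_const (deriv f p * c)
    exact this.deriv
  have h2 : deriv (deriv F) 0 = 2 * (deriv (deriv f) p * c / (2 * deriv f p)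
      - (starRingEnd ℂ) p) := by
    rw [hF'.deriv_eq]
    have e1 := (hf.analyticAt hp).deriv.differentiableAt.hasDerivAt
    have e2 := hasDerivAt_diskShift_zero hp
    have e1' : HasDerivAt (deriv f) (deriv (deriv f) p) (diskShift p 0) := by simpa using e1
    have e3 := HasDerivAt.comp (0 : ℂ) e1' e2
    have e4 : HasDerivAt (fun x : ℂ => (1 + (starRingEnd ℂ) p * x) ^ 2)
        (2 * (starRingEnd ℂ) p) 0 := by
      have := (((hasDerivAt_id (0 : ℂ)).const_mul ((starRingEnd ℂ) p)).const_add 1).pow 2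
      exact this.congr_deriv (by simp)
    have e5 := ((e3.mul ((hasDerivAt_const (0 : ℂ) c).div e4 (by simp))).div_const
      (deriv f p * c))
    refine e5.deriv.trans ?_
    simp
    field_simp
    rw [hcdef]
    push_cast
    ring
  rw [secondCoeff_eq] at h2
  rwa [← mul_left_cancel₀ two_ne_zero h2]

theorem hasDerivAt_preSchwarzian (hf : IsConvexMapping f) {z : ℂ} (hz : ‖z‖ < 1) :
    HasDerivAt (fun x => deriv (deriv f) x / deriv f x)
      (deriv (fun x => deriv (deriv f) x / deriv f x) z) z :=
  ((hf.analyticAt hz).deriv.deriv.differentiableAt.div (hf.analyticAt hz).deriv.differentiableAt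
    (hf.deriv_ne_zero hz)).hasDerivAt

/-- The Koebe coefficient bound, squared and divided by `1 - |z|²`. By `norm_sq_two_add_sub` it says
`|q| ≤ |2 + z q|` for the pre-Schwarzian `q`. -/
theorem preSchwarzian_bound (hf : IsConvexMapping f) {z : ℂ} (hz : ‖z‖ < 1) :
    (1 - ‖z‖ ^ 2) * ‖deriv (deriv f) z / deriv f z‖ ^ 2 ≤
      4 + 4 * (z * (deriv (deriv f) z / deriv f z)).re := by
  have h := hf.norm_koebe_secondCoeff_le_one hz
  set q := deriv (deriv f) z / deriv f z with hq
  have hm : 0 < 1 - ‖z‖ ^ 2 := by nlinarith [norm_nonneg z]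
  have e : deriv (deriv f) z * (1 - (‖z‖ ^ 2 : ℝ)) / (2 * deriv f z)
      = ((1 - ‖z‖ ^ 2) / 2 : ℝ) * q := by
    rw [hq]
    have := hf.deriv_ne_zero hz
    push_cast
    field_simp
  rw [e] at h
  set m := 1 - ‖z‖ ^ 2 with hm'
  have h2 : ‖((m / 2 : ℝ) : ℂ) * q - (starRingEnd ℂ) z‖ ^ 2
      = m ^ 2 / 4 * ‖q‖ ^ 2 - m * (z * q).re + ‖z‖ ^ 2 := by
    simp only [Complex.sq_norm, Complex.normSq_apply]
    simp
    ring
  have h3 : ‖((m / 2 : ℝ) : ℂ) * q - (starRingEnd ℂ) z‖ ^ 2 ≤ 1 :=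
    pow_le_one₀ (norm_nonneg _) h
  rw [h2] at h3
  have h4 : m * (m * ‖q‖ ^ 2) ≤ m * (4 + 4 * (z * q).re) := by nlinarith
  exact le_of_mul_le_mul_left h4 hm

theorem norm_sq_two_add_sub (z q : ℂ) :
    ‖2 + z * q‖ ^ 2 - ‖q‖ ^ 2 = 4 + 4 * (z * q).re - (1 - ‖z‖ ^ 2) * ‖q‖ ^ 2 := by
  simp only [Complex.sq_norm, Complex.normSq_apply]
  simp
  ring

/-- Nehari's bound for the Schwarzian derivative of a convex mapping. -/
theorem schwarzian_bound (hf : IsConvexMapping f) {z : ℂ} (hz : ‖z‖ < 1) :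
    ‖deriv (fun x => deriv (deriv f) x / deriv f x) z - (deriv (deriv f) z / deriv f z) ^ 2 / 2‖
      * (1 - ‖z‖ ^ 2) ^ 2 ≤ 2 := by
  set q : ℂ → ℂ := fun x => deriv (deriv f) x / deriv f x with hq
  have hqle : ∀ x : ℂ, ‖x‖ < 1 → ‖q x‖ ≤ ‖2 + x * q x‖ := fun x hx => by
    have h1 := hf.preSchwarzian_bound hx
    have h2 := norm_sq_two_add_sub x (q x)
    exact le_of_sq_le_sq (by simp only [hq] at h2 ⊢; linarith) (norm_nonneg _)
  have hne : ∀ x : ℂ, ‖x‖ < 1 → 2 + x * q x ≠ 0 := fun x hx h => by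
    have h1 := hqle x hx
    rw [h, norm_zero, norm_le_zero_iff] at h1
    rw [h1] at h
    norm_num at h
  -- `φ` maps into the closed disk, and its derivative is a multiple of the Schwarzian, `2 S / (2 +
  -- z q)²`; so Schwarz-Pick for `φ` bounds `S`.
  set φ : ℂ → ℂ := fun x => q x / (2 + x * q x) with hφ
  have hφd : ∀ x : ℂ, ‖x‖ < 1 → HasDerivAt φ
      (2 * (deriv q x - q x ^ 2 / 2) / (2 + x * q x) ^ 2) x := fun x hx => by
    have h1 : HasDerivAt q (deriv q x) x := hf.hasDerivAt_preSchwarzian hx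
    refine (h1.div (((hasDerivAt_id x).mul h1).const_add 2) (hne x hx)).congr_deriv ?_
    simp only [id]
    congr 1
    simp
    ring
  have hφm : MapsTo φ (ball 0 1) (closedBall 0 1) := fun x hx => by
    have hx1 : ‖x‖ < 1 := by simpa using hx
    rw [mem_closedBall_zero_iff, hφ, norm_div]
    exact div_le_one_of_le₀ (hqle x hx1) (norm_nonneg _)
  have h := schwarzPick_of_mapsTo_closedBall
    (fun x hx => (hφd x (by simpa using hx)).differentiableAt.differentiableWithinAt) hφm hz
  rw [(hφd z hz).deriv] at h
  have hpos : 0 < ‖2 + z * q z‖ := norm_pos_iff.2 (hne z hz)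
  simp only [norm_div, norm_mul, norm_pow, hφ] at h
  have hm : 0 < 1 - ‖z‖ ^ 2 := by nlinarith [norm_nonneg z]
  set m := 1 - ‖z‖ ^ 2 with hm'
  set S := ‖deriv q z - q z ^ 2 / 2‖ with hS
  have h2 : 2 * S * m ≤ ‖2 + z * q z‖ ^ 2 - ‖q z‖ ^ 2 := by
    have := mul_le_mul_of_nonneg_right h (sq_nonneg ‖2 + z * q z‖)
    have e1 : ‖(2 : ℂ)‖ * S / ‖2 + z * q z‖ ^ 2 * m * ‖2 + z * q z‖ ^ 2 = 2 * S * m := by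
      rw [Complex.norm_ofNat]
      field_simp
    have e2 : (1 - (‖q z‖ / ‖2 + z * q z‖) ^ 2) * ‖2 + z * q z‖ ^ 2
        = ‖2 + z * q z‖ ^ 2 - ‖q z‖ ^ 2 := by
      field_simp
    rwa [e1, e2] at this
  rw [norm_sq_two_add_sub, ← hm'] at h2
  have h3 : (z * q z).re ≤ ‖z‖ * ‖q z‖ := (Complex.re_le_norm _).trans (norm_mul _ _).le
  have h4 : m * (2 * S * m) ≤ m * (4 + 4 * (z * q z).re - m * ‖q z‖ ^ 2) :=
    mul_le_mul_of_nonneg_left h2 hm.le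
  have h5 : m * (z * q z).re ≤ m * (‖z‖ * ‖q z‖) := mul_le_mul_of_nonneg_left h3 hm.le
  have h6 : ‖z‖ ^ 2 = 1 - m := by rw [hm']; ring
  show S * m ^ 2 ≤ 2
  -- Multiplied by `m`, the bound reads `2 S m² ≤ 4 - (2|z| - m|q|)²`.
  nlinarith [sq_nonneg (2 * ‖z‖ - m * ‖q z‖)]

end IsConvexMapping

/-- The data of a curve along which the Schwarzian derivative has nonpositive real part: `F₁` is
the velocity, `Q` its logarithmic derivative and `Q'` the derivative of `Q`. -/
structure HasNonposSchwarzian (F₁ Q Q' : ℝ → ℂ) : Prop where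
  ne_zero : ∀ s, F₁ s ≠ 0
  hasDerivAt : ∀ s, HasDerivAt F₁ (Q s * F₁ s) s
  hasDerivAt_log : ∀ s, HasDerivAt Q (Q' s) s
  schwarzian_nonpos : ∀ s, (Q' s - Q s ^ 2 / 2).re ≤ 0
  norm_zero : ‖F₁ 0‖ = 1
  log_zero : (Q 0).re = 0

/-! ### Speed estimates along curves with nonpositive Schwarzian -/

namespace HasNonposSchwarzian

open Set

/-- The inverse square root of the speed. -/
noncomputable def weight (F₁ : ℝ → ℂ) (s : ℝ) : ℝ := (‖F₁ s‖ ^ 2) ^ (-(1 / 4) : ℝ)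

variable {F₁ Q Q' : ℝ → ℂ}

theorem weight_pos (h : HasNonposSchwarzian F₁ Q Q') (s : ℝ) : 0 < weight F₁ s := by
  have := norm_pos_iff.2 (h.ne_zero s)
  unfold weight
  positivity

theorem weight_zero (h : HasNonposSchwarzian F₁ Q Q') : weight F₁ 0 = 1 := by
  simp [weight, h.norm_zero]

theorem norm_mul_weight_sq (h : HasNonposSchwarzian F₁ Q Q') (s : ℝ) :
    ‖F₁ s‖ * weight F₁ s ^ 2 = 1 := by
  have hp := norm_pos_iff.2 (h.ne_zero s)
  have e : weight F₁ s ^ 2 = ‖F₁ s‖⁻¹ := by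
    rw [weight, ← Real.rpow_natCast, ← Real.rpow_natCast, ← Real.rpow_mul hp.le,
      ← Real.rpow_mul hp.le, ← Real.rpow_neg_one]
    norm_num
  rw [e, mul_inv_cancel₀ hp.ne']

theorem hasDerivAt_weight (h : HasNonposSchwarzian F₁ Q Q') (s : ℝ) :
    HasDerivAt (weight F₁) (-(Q s).re / 2 * weight F₁ s) s := by
  have hp := norm_pos_iff.2 (h.ne_zero s)
  have h1 := (h.hasDerivAt s).norm_sq
  have h2 := h1.rpow_const (p := (-(1 / 4) : ℝ)) (Or.inl (by positivity))
  refine h2.congr_deriv ?_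
  have e1 : (inner ℝ (F₁ s) (Q s * F₁ s)) = (Q s).re * ‖F₁ s‖ ^ 2 := by
    rw [Complex.sq_norm, Complex.normSq_apply]
    simp [Complex.inner]
    ring
  have e2 : (‖F₁ s‖ ^ 2) ^ (-(1 / 4) - 1 : ℝ) = weight F₁ s / ‖F₁ s‖ ^ 2 := by
    rw [Real.rpow_sub_one (by positivity), weight]
  rw [e1, e2]
  field_simp
  ring

theorem hasDerivAt_weight_slope (h : HasNonposSchwarzian F₁ Q Q') (s : ℝ) :
    HasDerivAt (fun s => -(Q s).re / 2 * weight F₁ s)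
      ((-(Q' s - Q s ^ 2 / 2).re / 2 + (Q s).im ^ 2 / 4) * weight F₁ s) s := by
  have h1 : HasDerivAt (fun s => (Q s).re) (Q' s).re s := by
    have := (Complex.reCLM.hasFDerivAt (x := Q s)).comp_hasDerivAt s (h.hasDerivAt_log s)
    exact this
  refine ((h1.neg.div_const 2).mul (h.hasDerivAt_weight s)).congr_deriv ?_
  have : (Q s ^ 2 / 2).re = ((Q s).re ^ 2 - (Q s).im ^ 2) / 2 := by
    rw [show Q s ^ 2 / 2 = ((1 / 2 : ℝ) : ℂ) * Q s ^ 2 by push_cast; ring, Complex.re_ofReal_mul]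
    simp [sq]
    ring
  rw [Complex.sub_re, this]
  simp only [Pi.neg_apply]
  ring

theorem monotone_weight_slope (h : HasNonposSchwarzian F₁ Q Q') :
    Monotone (fun s => -(Q s).re / 2 * weight F₁ s) := by
  refine monotone_of_deriv_nonneg (fun s => (h.hasDerivAt_weight_slope s).differentiableAt)
    fun s => ?_
  rw [(h.hasDerivAt_weight_slope s).deriv]
  have := h.schwarzian_nonpos s
  exact mul_nonneg (add_nonneg (by linarith) (by positivity)) (h.weight_pos s).le

/-- The second derivative is the weight times `-Re(S)/2 + (Im Q)²/4`, with `S` the Schwarzian, and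
both terms are nonnegative. -/
theorem convexOn_weight (h : HasNonposSchwarzian F₁ Q Q') : ConvexOn ℝ univ (weight F₁) := by
  refine Monotone.convexOn_univ_of_deriv (fun s => (h.hasDerivAt_weight s).differentiableAt) ?_
  rw [show deriv (weight F₁) = fun s => -(Q s).re / 2 * weight F₁ s from
    funext fun s => (h.hasDerivAt_weight s).deriv]
  exact h.monotone_weight_slope

theorem one_le_weight (h : HasNonposSchwarzian F₁ Q Q') {s : ℝ} (hs : 0 ≤ s) :
    1 ≤ weight F₁ s := by
  have : MonotoneOn (weight F₁) (Ici 0) := by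
    refine monotoneOn_of_deriv_nonneg (convex_Ici 0)
      (fun s _ => (h.hasDerivAt_weight s).continuousAt.continuousWithinAt)
      (fun s _ => (h.hasDerivAt_weight s).differentiableAt.differentiableWithinAt) fun s hs => ?_
    rw [(h.hasDerivAt_weight s).deriv]
    rw [interior_Ici] at hs
    have := h.monotone_weight_slope (le_of_lt hs : (0 : ℝ) ≤ s)
    simpa [h.log_zero] using this
  have := this self_mem_Ici hs hs
  rwa [h.weight_zero] at this

/-- Beyond `s₁` a convex function stays above the chord through its values at 0 and `s₁`. -/
theorem linear_le_weight (h : HasNonposSchwarzian F₁ Q Q') {κ s₁ s : ℝ} (hs₁ : 0 < s₁)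
    (hκ : 1 + κ * s₁ ≤ weight F₁ s₁) (hs : s₁ ≤ s) : 1 + κ * s ≤ weight F₁ s := by
  have hs0 : 0 < s := hs₁.trans_le hs
  have h1 := h.convexOn_weight.2 (mem_univ 0) (mem_univ s)
    (sub_nonneg.2 ((div_le_one hs0).2 hs)) (div_nonneg hs₁.le hs0.le) (by ring)
  simp only [smul_eq_mul, mul_zero, zero_add, h.weight_zero, mul_one] at h1
  rw [div_mul_cancel₀ _ hs0.ne'] at h1
  have h2 : κ * s₁ ≤ s₁ / s * (weight F₁ s - 1) := by linarith
  rw [div_mul_eq_mul_div, le_div_iff₀ hs0] at h2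
  have h3 : s₁ * (κ * s) ≤ s₁ * (weight F₁ s - 1) := by linarith
  linarith [le_of_mul_le_mul_left h3 hs₁]

/-- The speed is the weight to the power -2, hence at most `(1 + κ x)⁻²`; the bound is the integral
of this from `s` to infinity. It depends on the curve only through `κ` and `s₁`, which makes it
uniform over nearby rays. -/
theorem norm_sub_le (h : HasNonposSchwarzian F₁ Q Q') {F : ℝ → ℂ}
    (hF : ∀ s, HasDerivAt F (F₁ s) s) {κ s₁ s t : ℝ} (hκ0 : 0 < κ) (hs₁ : 0 < s₁)
    (hκ : 1 + κ * s₁ ≤ weight F₁ s₁) (hs : s₁ ≤ s) (hst : s ≤ t) :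
    ‖F t - F s‖ ≤ (κ * (1 + κ * s))⁻¹ := by
  have hs0 : 0 < s := hs₁.trans_le hs
  have hBd : ∀ x, s ≤ x → HasDerivAt
      (fun x => (κ * (1 + κ * s))⁻¹ - (κ * (1 + κ * x))⁻¹) (((1 + κ * x) ^ 2)⁻¹) x := by
    intro x hx
    have hx0 : 0 < 1 + κ * x := by have := hs0.trans_le hx; positivity
    have h1 : HasDerivAt (fun x => κ * (1 + κ * x)) (κ * κ) x := by
      have := (((hasDerivAt_id x).const_mul κ).const_add 1).const_mul κ
      simpa using this
    refine ((h1.inv (by positivity)).const_sub _).congr_deriv ?_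
    field_simp
  have key := image_norm_le_of_norm_deriv_right_le_deriv_boundary' (a := s) (b := t)
    (f := fun x => F x - F s) (f' := F₁)
    (B := fun x => (κ * (1 + κ * s))⁻¹ - (κ * (1 + κ * x))⁻¹)
    (B' := fun x => ((1 + κ * x) ^ 2)⁻¹)
    (fun x _ => ((hF x).sub_const _).continuousAt.continuousWithinAt)
    (fun x _ => ((hF x).sub_const _).hasDerivWithinAt) (by simp)
    (fun x hx => (hBd x hx.1).continuousAt.continuousWithinAt)
    (fun x hx => (hBd x hx.1).hasDerivWithinAt) (fun x hx => by
      have hx0 : 0 < 1 + κ * x := by have := hs0.trans_le hx.1; positivity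
      have h1 := h.linear_le_weight hs₁ hκ (hs.trans hx.1)
      have h2 := pow_le_pow_left₀ hx0.le h1 2
      have h3 := h.norm_mul_weight_sq x
      have hp := norm_pos_iff.2 (h.ne_zero x)
      rw [← one_div, le_div_iff₀ (by positivity)]
      exact (mul_le_mul_of_nonneg_left h2 hp.le).trans h3.le) (right_mem_Icc.2 hst)
  have : 0 ≤ (κ * (1 + κ * t))⁻¹ := by
    have := hs0.trans_le hst
    positivity
  linarith

/-- Otherwise the weight is identically 1 on the positive axis. Its first derivative then kills `Re
Q`, its second `Im Q`, so the velocity is constant of norm 1 and the curve runs to infinity along a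
line. -/
theorem exists_one_lt_weight (h : HasNonposSchwarzian F₁ Q Q') {F : ℝ → ℂ}
    (hF : ∀ s, HasDerivAt F (F₁ s) s) {C : ℝ} (hC : ∀ s, ‖F s‖ ≤ C) :
    ∃ s, 0 < s ∧ 1 < weight F₁ s := by
  by_contra! hcon
  have hW : ∀ s, 0 < s → weight F₁ s = 1 := fun s hs =>
    le_antisymm (hcon s hs) (h.one_le_weight hs.le)
  have hre : ∀ s, 0 < s → (Q s).re = 0 := fun s hs => by
    have h1 : HasDerivAt (weight F₁) 0 s := by
      refine (hasDerivAt_const s (1 : ℝ)).congr_of_eventuallyEq ?_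
      filter_upwards [Ioi_mem_nhds hs] with x hx using hW x hx
    have h2 := (h.hasDerivAt_weight s).unique h1
    rw [hW s hs] at h2
    linarith
  have him : ∀ s, 0 < s → (Q s).im = 0 := fun s hs => by
    have h1 : HasDerivAt (fun s => -(Q s).re / 2 * weight F₁ s) 0 s := by
      refine (hasDerivAt_const s (0 : ℝ)).congr_of_eventuallyEq ?_
      filter_upwards [Ioi_mem_nhds hs] with x hx
      simp [hre x hx]
    have h2 := (h.hasDerivAt_weight_slope s).unique h1
    rw [hW s hs] at h2
    have := h.schwarzian_nonpos s
    have : (Q s).im ^ 2 ≤ 0 := by linarith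
    exact pow_eq_zero_iff two_ne_zero |>.1 (le_antisymm this (sq_nonneg _))
  have hconst : ∀ s, 0 ≤ s → F₁ s = F₁ 0 := fun s hs => by
    refine constant_of_derivWithin_zero (a := 0) (b := s) (f := F₁)
      (fun x _ => (h.hasDerivAt x).differentiableAt.differentiableWithinAt) ?_ s
      (right_mem_Icc.2 hs)
    intro x hx
    have hQ0 : Q x = 0 := by
      rcases hx.1.eq_or_lt with h0 | h0
      -- At 0 only the real part of `Q` is given to vanish; the rest follows by continuity from the
      -- right.
      · subst h0
        have h1 : Tendsto Q (𝓝[>] 0) (𝓝 (Q 0)) :=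
          (h.hasDerivAt_log 0).continuousAt.tendsto.mono_left nhdsWithin_le_nhds
        have h2 : Tendsto Q (𝓝[>] 0) (𝓝 0) := by
          refine tendsto_const_nhds.congr' ?_
          filter_upwards [self_mem_nhdsWithin] with y hy
          exact (Complex.ext (hre y hy) (him y hy)).symm
        exact tendsto_nhds_unique h1 h2
      · exact Complex.ext (hre x h0) (him x h0)
    rw [(h.hasDerivAt x).hasDerivWithinAt.derivWithin
      (uniqueDiffOn_Icc (hx.1.trans_lt hx.2) x ⟨hx.1, hx.2.le⟩), hQ0, zero_mul]
  have hlin : ∀ s, 0 ≤ s → F s - s * F₁ 0 = F 0 := fun s hs => by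
    have hd : ∀ x, HasDerivAt (fun s : ℝ => F s - s * F₁ 0) (F₁ x - F₁ 0) x := fun x => by
      have := (hF x).sub ((Complex.ofRealCLM.hasDerivAt (x := x)).mul_const (F₁ 0))
      exact this.congr_deriv (by simp)
    have := constant_of_derivWithin_zero (a := 0) (b := s) (f := fun s : ℝ => F s - s * F₁ 0)
      (fun x _ => (hd x).differentiableAt.differentiableWithinAt) (fun x hx => by
        rw [(hd x).hasDerivWithinAt.derivWithin
          (uniqueDiffOn_Icc (hx.1.trans_lt hx.2) x ⟨hx.1, hx.2.le⟩), hconst x hx.1, sub_self]) s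
      (right_mem_Icc.2 hs)
    simpa using this
  have hC0 : 0 ≤ C := (norm_nonneg _).trans (hC 0)
  have h1 := hlin (2 * C + 1) (by linarith)
  have h2 : ‖((2 * C + 1 : ℝ) : ℂ) * F₁ 0‖ ≤ C + C := by
    rw [show ((2 * C + 1 : ℝ) : ℂ) * F₁ 0 = F (2 * C + 1) - F 0 by rw [← h1]; ring]
    exact (_root_.norm_sub_le _ _).trans (add_le_add (hC _) (hC _))
  rw [norm_mul, h.norm_zero, mul_one, Complex.norm_of_nonneg (by linarith)] at h2
  linarith

end HasNonposSchwarzian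

/-! ### Radial limits and the continuous extension -/

theorem hasDerivAt_real_tanh (s : ℝ) : HasDerivAt Real.tanh (1 - Real.tanh s ^ 2) s := by
  have hc := (Real.cosh_pos s).ne'
  have h := (Real.hasDerivAt_sinh s).div (Real.hasDerivAt_cosh s) hc
  have e : Real.tanh = Real.sinh / Real.cosh := by
    ext x
    exact Real.tanh_eq_sinh_div_cosh x
  rw [e]
  refine h.congr_deriv ?_
  simp only [Pi.div_apply]
  field_simp

namespace IsConvexMapping

open Metric Set

variable {f : ℂ → ℂ}

/-- The velocity of `f*` along the ray through `ζ`, in hyperbolic arc length. -/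
noncomputable def rayVelocity (f : ℂ → ℂ) (ζ : ℂ) (s : ℝ) : ℂ :=
  (1 - (Real.tanh s : ℂ) ^ 2) * ζ *
    (deriv f (ζ * Real.tanh s) / (1 + secondCoeff f * f (ζ * Real.tanh s)) ^ 2)

/-- The pre-Schwarzian derivative of `f*`. -/
noncomputable def starPreSchwarzian (f : ℂ → ℂ) (z : ℂ) : ℂ :=
  deriv (deriv f) z / deriv f z - 2 * (secondCoeff f * deriv f z / (1 + secondCoeff f * f z))

theorem norm_ray_lt_one {ζ : ℂ} (hζ : ‖ζ‖ = 1) (s : ℝ) : ‖ζ * (Real.tanh s : ℂ)‖ < 1 := by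
  rw [norm_mul, hζ, one_mul, Complex.norm_real]
  exact Real.abs_tanh_lt_one s

theorem hasDerivAt_ray (ζ : ℂ) (s : ℝ) : HasDerivAt (fun s : ℝ => ζ * (Real.tanh s : ℂ))
    ((1 - (Real.tanh s : ℂ) ^ 2) * ζ) s := by
  have h := ((hasDerivAt_real_tanh s).ofReal_comp).const_mul ζ
  refine h.congr_deriv ?_
  push_cast
  ring

theorem hasDerivAt_fStar_ray (hf : IsConvexMapping f) {ζ : ℂ} (hζ : ‖ζ‖ = 1) (s : ℝ) :
    HasDerivAt (fun s : ℝ => fStar f (ζ * Real.tanh s)) (rayVelocity f ζ s) s := by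
  have h := HasDerivAt.comp s (hf.hasDerivAt_fStar (norm_ray_lt_one hζ s)) (hasDerivAt_ray ζ s)
  exact h.congr_deriv (by rw [rayVelocity, mul_comm])

/-- Moebius invariance: `f*` and `f` have the same Schwarzian. -/
theorem hasDerivAt_starPreSchwarzian (hf : IsConvexMapping f) {z : ℂ} (hz : ‖z‖ < 1) :
    HasDerivAt (starPreSchwarzian f)
      (deriv (fun x => deriv (deriv f) x / deriv f x) z - (deriv (deriv f) z / deriv f z) ^ 2 / 2
        + starPreSchwarzian f z ^ 2 / 2) z := by
  have h1 := hf.hasDerivAt_preSchwarzian hz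
  have h2 := (hf.analyticAt hz).deriv.differentiableAt.hasDerivAt.const_mul (secondCoeff f)
  have h3 := ((hf.differentiableAt hz).hasDerivAt.const_mul (secondCoeff f)).const_add 1
  have hne := hf.one_add_ne_zero hz
  have hd := hf.deriv_ne_zero hz
  refine (h1.sub ((h2.div h3 hne).const_mul 2)).congr_deriv ?_
  rw [starPreSchwarzian]
  generalize deriv (fun x => deriv (deriv f) x / deriv f x) z = A
  field_simp
  ring

theorem hasDerivAt_starVelocity (hf : IsConvexMapping f) {z : ℂ} (hz : ‖z‖ < 1) :
    HasDerivAt (fun z => deriv f z / (1 + secondCoeff f * f z) ^ 2)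
      (starPreSchwarzian f z * (deriv f z / (1 + secondCoeff f * f z) ^ 2)) z := by
  have h2 := (hf.analyticAt hz).deriv.differentiableAt.hasDerivAt
  have h3 := (((hf.differentiableAt hz).hasDerivAt.const_mul (secondCoeff f)).const_add 1).pow 2
  have hne := hf.one_add_ne_zero hz
  have hd := hf.deriv_ne_zero hz
  refine (h2.div h3 (pow_ne_zero 2 hne)).congr_deriv ?_
  rw [starPreSchwarzian]
  simp only [Pi.pow_apply]
  field_simp
  push_cast
  ring

/-- Since tanh has Schwarzian -2, the Schwarzian along the ray is `(1 - tanh²)² ζ² S_f - 2`, and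
Nehari's bound says exactly that the first term has modulus at most 2. The logarithmic derivative
vanishes at 0 because `f*` has no second coefficient. -/
theorem hasNonposSchwarzian_ray (hf : IsConvexMapping f) {ζ : ℂ} (hζ : ‖ζ‖ = 1) :
    HasNonposSchwarzian (rayVelocity f ζ)
      (fun s => (1 - (Real.tanh s : ℂ) ^ 2) * ζ * starPreSchwarzian f (ζ * Real.tanh s)
        - 2 * Real.tanh s)
      (fun s => ((1 - (Real.tanh s : ℂ) ^ 2) * ζ) ^ 2 *
          (deriv (fun x => deriv (deriv f) x / deriv f x) (ζ * Real.tanh s)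
            - (deriv (deriv f) (ζ * Real.tanh s) / deriv f (ζ * Real.tanh s)) ^ 2 / 2
            + starPreSchwarzian f (ζ * Real.tanh s) ^ 2 / 2)
        - 2 * Real.tanh s * (1 - (Real.tanh s : ℂ) ^ 2) * ζ *
          starPreSchwarzian f (ζ * Real.tanh s) - 2 * (1 - (Real.tanh s : ℂ) ^ 2)) := by
  have ht : ∀ s : ℝ, HasDerivAt (fun s : ℝ => (Real.tanh s : ℂ)) (1 - (Real.tanh s : ℂ) ^ 2) s :=
    fun s => ((hasDerivAt_real_tanh s).ofReal_comp).congr_deriv (by push_cast; ring)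
  have hm : ∀ s : ℝ, HasDerivAt (fun s : ℝ => (1 - (Real.tanh s : ℂ) ^ 2) * ζ)
      (-(2 * Real.tanh s * (1 - (Real.tanh s : ℂ) ^ 2)) * ζ) s := fun s =>
    ((((ht s).pow 2).const_sub 1).mul_const ζ).congr_deriv (by push_cast; ring)
  have hpos : ∀ s : ℝ, 0 < 1 - Real.tanh s ^ 2 := fun s => by
    have := Real.tanh_sq_lt_one s
    linarith
  have hζ0 : ζ ≠ 0 := by
    rintro rfl
    simp at hζ
  refine ⟨fun s => ?_, fun s => ?_, fun s => ?_, fun s => ?_, ?_, ?_⟩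
  · have hz := norm_ray_lt_one hζ s
    have h1 : (1 - (Real.tanh s : ℂ) ^ 2) ≠ 0 := by exact_mod_cast (hpos s).ne'
    exact mul_ne_zero (mul_ne_zero h1 hζ0)
      (div_ne_zero (hf.deriv_ne_zero hz) (pow_ne_zero 2 (hf.one_add_ne_zero hz)))
  · have h1 := (hm s).mul (HasDerivAt.comp s (hf.hasDerivAt_starVelocity (norm_ray_lt_one hζ s))
      (hasDerivAt_ray ζ s))
    refine h1.congr_deriv ?_
    rw [rayVelocity]
    simp only [Function.comp_apply]
    ring
  · have h1 := ((hm s).mul (HasDerivAt.comp s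
      (hf.hasDerivAt_starPreSchwarzian (norm_ray_lt_one hζ s)) (hasDerivAt_ray ζ s))).sub
      ((ht s).const_mul 2)
    refine h1.congr_deriv ?_
    simp only [Function.comp_apply]
    ring
  · set z := ζ * (Real.tanh s : ℂ) with hz
    have hb := hf.schwarzian_bound (norm_ray_lt_one hζ s)
    rw [← hz] at hb
    set S := deriv (fun x => deriv (deriv f) x / deriv f x) z
      - (deriv (deriv f) z / deriv f z) ^ 2 / 2
    have hzn : ‖z‖ ^ 2 = Real.tanh s ^ 2 := by
      rw [hz, norm_mul, hζ, one_mul, Complex.norm_real, Real.norm_eq_abs, sq_abs]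
    have e : ((1 - (Real.tanh s : ℂ) ^ 2) * ζ) ^ 2 * (S + starPreSchwarzian f z ^ 2 / 2)
        - 2 * Real.tanh s * (1 - (Real.tanh s : ℂ) ^ 2) * ζ * starPreSchwarzian f z
        - 2 * (1 - (Real.tanh s : ℂ) ^ 2)
        - ((1 - (Real.tanh s : ℂ) ^ 2) * ζ * starPreSchwarzian f z - 2 * Real.tanh s) ^ 2 / 2
        = ((1 - (Real.tanh s : ℂ) ^ 2) * ζ) ^ 2 * S - 2 := by ring
    rw [e, Complex.sub_re]
    have h1 : ‖((1 - (Real.tanh s : ℂ) ^ 2) * ζ) ^ 2 * S‖ ≤ 2 := by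
      rw [norm_mul, norm_pow, norm_mul, hζ, mul_one, mul_comm,
        show (1 - (Real.tanh s : ℂ) ^ 2) = ((1 - Real.tanh s ^ 2 : ℝ) : ℂ) by push_cast; ring,
        Complex.norm_of_nonneg (hpos s).le, ← hzn]
      exact hb
    have h2 := (Complex.re_le_norm _).trans h1
    simpa using h2
  · simp [rayVelocity, hζ, hf.deriv_zero, hf.map_zero]
  · simp [starPreSchwarzian, hf.deriv_zero, hf.map_zero, secondCoeff_eq]

theorem norm_fStar_lt (hf : IsConvexMapping f) (ha : secondCoeff f ≠ 0) {z : ℂ} (hz : ‖z‖ < 1) :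
    ‖fStar f z‖ < ‖secondCoeff f‖⁻¹ := by
  have h := hf.norm_mul_fStar_lt_one hz
  rw [norm_mul] at h
  rwa [← one_div, lt_div_iff₀ (norm_pos_iff.2 ha), mul_comm]

/-- `f*` has a limit at every point of the unit circle. -/
theorem exists_tendsto_fStar (hf : IsConvexMapping f) (ha : secondCoeff f ≠ 0) {ζ : ℂ}
    (hζ : ‖ζ‖ = 1) : ∃ y, Tendsto (fStar f) (𝓝[ball 0 1] ζ) (𝓝 y) := by
  obtain ⟨s₁, hs₁, hW⟩ := (hf.hasNonposSchwarzian_ray hζ).exists_one_lt_weight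
    (hf.hasDerivAt_fStar_ray hζ) (C := ‖secondCoeff f‖⁻¹)
    fun s => (hf.norm_fStar_lt ha (norm_ray_lt_one hζ s)).le
  set W := HasNonposSchwarzian.weight (rayVelocity f ζ) s₁ with hWdef
  -- Half the slope of the chord, so that the inequality at `s₁` is strict and persists for
  -- directions near `ζ`.
  set κ := (W - 1) / (2 * s₁) with hκ
  have hκ0 : 0 < κ := div_pos (by linarith) (by linarith)
  have hκW : 1 + κ * s₁ < W := by
    have : κ * s₁ = (W - 1) / 2 := by rw [hκ]; field_simp
    linarith
  have hcW : ContinuousAt (fun ξ => HasNonposSchwarzian.weight (rayVelocity f ξ) s₁) ζ := by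
    have h1 : ContinuousAt (fun ξ => rayVelocity f ξ s₁) ζ := by
      have h2 : ContinuousAt (fun z => deriv f z / (1 + secondCoeff f * f z) ^ 2)
          (ζ * Real.tanh s₁) :=
        (hf.hasDerivAt_starVelocity (norm_ray_lt_one hζ s₁)).continuousAt
      have h3 : ContinuousAt (fun ξ : ℂ => ξ * (Real.tanh s₁ : ℂ)) ζ := by fun_prop
      have h4 : ContinuousAt (fun ξ : ℂ => deriv f (ξ * Real.tanh s₁) /
          (1 + secondCoeff f * f (ξ * Real.tanh s₁)) ^ 2) ζ := ContinuousAt.comp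
        (g := fun z => deriv f z / (1 + secondCoeff f * f z) ^ 2)
        (f := fun ξ : ℂ => ξ * (Real.tanh s₁ : ℂ)) (x := ζ) h2 h3
      unfold rayVelocity
      exact (continuousAt_const.mul continuousAt_id).mul h4
    have hne := norm_pos_iff.2 ((hf.hasNonposSchwarzian_ray hζ).ne_zero s₁)
    unfold HasNonposSchwarzian.weight
    exact (h1.norm.pow 2).rpow_const (Or.inl (pow_pos hne 2).ne')
  have hevW := hcW.eventually (lt_mem_nhds hκW)
  have hbot : (𝓝[ball 0 1] ζ).NeBot := by
    rw [← mem_closure_iff_nhdsWithin_neBot, closure_ball 0 one_ne_zero]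
    simp [hζ]
  rw [← cauchy_map_iff_exists_tendsto, Metric.cauchy_iff]
  refine ⟨hbot.map _, fun ε hε => ?_⟩
  obtain ⟨s, hs, hsε⟩ : ∃ s, s₁ ≤ s ∧ (κ * (1 + κ * s))⁻¹ < ε / 4 := by
    have h1 : Tendsto (fun s : ℝ => (κ * (1 + κ * s))⁻¹) atTop (𝓝 0) := by
      refine tendsto_inv_atTop_zero.comp (Tendsto.const_mul_atTop hκ0 ?_)
      exact tendsto_atTop_add_const_left _ _ (tendsto_id.const_mul_atTop hκ0)
    have h2 := (h1.eventually (gt_mem_nhds (show (0 : ℝ) < ε / 4 by linarith))).and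
      (eventually_ge_atTop s₁)
    obtain ⟨s, h3, h4⟩ := h2.exists
    exact ⟨s, h4, h3⟩
  have hcF : ContinuousAt (fun ξ : ℂ => fStar f (ξ * Real.tanh s)) ζ :=
    ContinuousAt.comp (g := fStar f) (f := fun ξ : ℂ => ξ * (Real.tanh s : ℂ)) (x := ζ)
      (hf.hasDerivAt_fStar (norm_ray_lt_one hζ s)).continuousAt
      (show ContinuousAt (fun ξ : ℂ => ξ * (Real.tanh s : ℂ)) ζ by fun_prop)
  have hevF := hcF.eventually (ball_mem_nhds _ (show 0 < ε / 4 by linarith))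
  have hdir : Tendsto (fun z : ℂ => z / (‖z‖ : ℂ)) (𝓝[ball 0 1] ζ) (𝓝 ζ) := by
    have h1 : ContinuousAt (fun z : ℂ => z / (‖z‖ : ℂ)) ζ :=
      continuousAt_id.div (by fun_prop) (by simp [hζ])
    have h2 := h1.tendsto
    simp only [hζ, Complex.ofReal_one, div_one] at h2
    exact h2.mono_left nhdsWithin_le_nhds
  have hnear : ∀ᶠ z : ℂ in 𝓝[ball 0 1] ζ, max 0 (Real.tanh s) < ‖z‖ := by
    have h1 : ∀ᶠ z : ℂ in 𝓝 ζ, max 0 (Real.tanh s) < ‖z‖ := by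
      refine continuous_norm.continuousAt.eventually (lt_mem_nhds ?_)
      simp only [hζ]
      exact max_lt one_pos (Real.tanh_lt_one s)
    exact h1.filter_mono nhdsWithin_le_nhds
  -- Compare `f* z` with the value at hyperbolic radius `s` in its own direction by the uniform tail
  -- bound, then with the value in direction `ζ` by continuity.
  have hgood : ∀ᶠ z in 𝓝[ball 0 1] ζ, dist (fStar f z) (fStar f (ζ * Real.tanh s)) < ε / 2 := by
    filter_upwards [hdir.eventually hevW, hdir.eventually hevF, hnear, self_mem_nhdsWithin]
      with z h1 h2 h3 h4
    have hz1 : ‖z‖ < 1 := by simpa using h4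
    have hz0 : 0 < ‖z‖ := (le_max_left _ _).trans_lt h3
    have hz0' : (‖z‖ : ℂ) ≠ 0 := by exact_mod_cast hz0.ne'
    set ξ := z / (‖z‖ : ℂ) with hξ
    have hξ1 : ‖ξ‖ = 1 := by
      rw [hξ, norm_div, Complex.norm_real, norm_norm, div_self hz0.ne']
    have hzmem : ‖z‖ ∈ Ioo (-1 : ℝ) 1 := ⟨by linarith, hz1⟩
    have hzξ : z = ξ * (Real.tanh (Real.artanh ‖z‖) : ℝ) := by
      rw [Real.tanh_artanh hzmem, hξ, div_mul_cancel₀ _ hz0']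
    have hst : s ≤ Real.artanh ‖z‖ := by
      have h5 := Real.artanh_le_artanh (Real.neg_one_lt_tanh s) hz1
        ((le_max_right _ _).trans h3.le)
      rwa [Real.artanh_tanh] at h5
    have h6 := (hf.hasNonposSchwarzian_ray hξ1).norm_sub_le (hf.hasDerivAt_fStar_ray hξ1)
      hκ0 hs₁ h1.le hs hst
    rw [← hzξ, ← dist_eq_norm] at h6
    have h7 := dist_triangle (fStar f z) (fStar f (ξ * Real.tanh s)) (fStar f (ζ * Real.tanh s))
    have h8 : dist (fStar f (ξ * Real.tanh s)) (fStar f (ζ * Real.tanh s)) < ε / 4 := h2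
    linarith
  refine ⟨_, image_mem_map hgood, ?_⟩
  rintro _ ⟨x, hx, rfl⟩ _ ⟨y, hy, rfl⟩
  have hx' : dist (fStar f x) (fStar f (ζ * Real.tanh s)) < ε / 2 := hx
  have hy' : dist (fStar f y) (fStar f (ζ * Real.tanh s)) < ε / 2 := hy
  have := dist_triangle_right (fStar f x) (fStar f y) (fStar f (ζ * Real.tanh s))
  linarith

theorem nhdsWithin_ball_neBot {ζ : ℂ} (hζ : ‖ζ‖ ≤ 1) : (𝓝[ball 0 1] ζ).NeBot := by
  rw [← mem_closure_iff_nhdsWithin_neBot, closure_ball 0 one_ne_zero]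
  simpa using hζ

theorem continuousAt_fStar (hf : IsConvexMapping f) {z : ℂ} (hz : ‖z‖ < 1) :
    ContinuousAt (fStar f) z := (hf.hasDerivAt_fStar hz).continuousAt

theorem continuousOn_fStarExt (hf : IsConvexMapping f) (ha : secondCoeff f ≠ 0) :
    ContinuousOn (fStarExt f) (closedBall 0 1) := by
  refine continuousOn_extendFrom (by rw [closure_ball 0 one_ne_zero]) fun x hx => ?_
  rcases (mem_closedBall_zero_iff.1 hx).lt_or_eq with h | h
  · exact ⟨_, (hf.continuousAt_fStar h).continuousWithinAt⟩
  · exact hf.exists_tendsto_fStar ha h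

theorem eqOn_fStarExt (hf : IsConvexMapping f) : EqOn (fStarExt f) (fStar f) (ball 0 1) :=
  fun x hx => extendFrom_eq (subset_closure hx)
    (hf.continuousAt_fStar (by simpa using hx)).continuousWithinAt

theorem tendsto_fStarExt (hf : IsConvexMapping f) (ha : secondCoeff f ≠ 0) {ζ : ℂ}
    (hζ : ‖ζ‖ = 1) : Tendsto (fStar f) (𝓝[ball 0 1] ζ) (𝓝 (fStarExt f ζ)) :=
  tendsto_extendFrom (hf.exists_tendsto_fStar ha hζ)

end IsConvexMapping

/-! ### Uniqueness of boundary points with a given value -/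

section BoundaryUniqueness

open Metric Set

variable {G : ℂ → ℂ} {β : ℂ}

/-- If every line through the origin with direction in a nonempty open set has an end point on the
unit circle where `G = β`, then `G` takes the value `β` at the origin. -/
theorem eq_of_eq_on_open_directions (hc : ContinuousOn G (closedBall 0 1))
    (hd : DifferentiableOn ℂ G (ball 0 1)) {A : Set ℂ} (hA : IsOpen A) {ξ₀ : ℂ} (hξ₀ : ‖ξ₀‖ = 1)
    (hξA : ξ₀ ∈ A) (h : ∀ ξ ∈ A, ‖ξ‖ = 1 → G ξ = β ∨ G (-ξ) = β) : G 0 = β := by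
  have hcover : sphere (0 : ℂ) 1 ⊆ ⋃ l : sphere (0 : ℂ) 1, (fun z => (l : ℂ) * z) ⁻¹' A := by
    intro ζ hζ
    have hζ1 : ‖ζ‖ = 1 := by simpa using hζ
    have hζ0 : ζ ≠ 0 := by
      rintro rfl
      simp at hζ1
    refine mem_iUnion.2 ⟨⟨ξ₀ / ζ, by simp [hξ₀, hζ1]⟩, ?_⟩
    simpa [div_mul_cancel₀ _ hζ0] using hξA
  obtain ⟨Λ, hΛ⟩ := (isCompact_sphere (0 : ℂ) 1).elim_finite_subcover _
    (fun l => hA.preimage (by fun_prop)) hcover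
  -- Finitely many rotates of `A` cover the circle, so some factor of `P` vanishes at each point of
  -- it. By the maximum principle `P` vanishes at 0, where all factors are `G 0 - β`.
  set P : ℂ → ℂ := fun z => ∏ l ∈ Λ, (G (l * z) - β) * (G (-(l * z)) - β) with hP
  have hl : ∀ l : sphere (0 : ℂ) 1, ‖(l : ℂ)‖ = 1 := fun l => by simp
  have hPc : ContinuousOn P (closedBall 0 1) := by
    refine continuousOn_finsetProd _ fun l _ => ?_
    refine ContinuousOn.mul ?_ ?_
    · exact (hc.comp (t := closedBall 0 1) (by fun_prop) fun z hz => by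
        simpa using hz).sub continuousOn_const
    · exact (hc.comp (t := closedBall 0 1) (by fun_prop) fun z hz => by
        simpa using hz).sub continuousOn_const
  have hPd : DifferentiableOn ℂ P (ball 0 1) := by
    refine DifferentiableOn.fun_finsetProd fun l _ => ?_
    refine DifferentiableOn.mul ?_ ?_
    · exact (hd.comp (t := ball 0 1) (by fun_prop) fun z hz => by simpa using hz).sub_const _
    · exact (hd.comp (t := ball 0 1) (by fun_prop) fun z hz => by simpa using hz).sub_const _
  have hPcl : DiffContOnCl ℂ P (ball 0 1) :=
    ⟨hPd, by rwa [closure_ball 0 one_ne_zero]⟩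
  have h0 := Complex.norm_le_of_forall_mem_frontier_norm_le (C := 0) isBounded_ball hPcl
    (fun z hz => by
      rw [frontier_ball 0 one_ne_zero] at hz
      obtain ⟨l, hlΛ, hlA⟩ := mem_iUnion₂.1 (hΛ hz)
      have hz1 : ‖z‖ = 1 := by simpa using hz
      rw [hP, norm_le_zero_iff]
      refine Finset.prod_eq_zero hlΛ ?_
      rcases h _ hlA (by simp [hz1]) with h1 | h1
      · rw [h1, sub_self, zero_mul]
      · rw [h1, sub_self, mul_zero])
    (subset_closure (mem_ball_self one_pos))
  rw [norm_le_zero_iff, hP] at h0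
  obtain ⟨l, -, h1⟩ := Finset.prod_eq_zero_iff.1 h0
  simpa [sub_eq_zero] using h1

/-- Two points of the unit circle that are joined inside arbitrarily small sublevel sets of
`|G - β|` coincide, provided `G` omits `β` in the disk. -/
theorem eq_of_isPreconnected_sublevel (hc : ContinuousOn G (closedBall 0 1))
    (hd : DifferentiableOn ℂ G (ball 0 1)) (hβ : ∀ z ∈ ball (0 : ℂ) 1, G z ≠ β) {ζ₁ ζ₂ : ℂ}
    (h₁ : ‖ζ₁‖ = 1) (h₂ : ‖ζ₂‖ = 1)
    (hK : ∀ ε > 0, ∃ K ⊆ ball (0 : ℂ) 1, IsPreconnected K ∧ (∀ z ∈ K, ‖G z - β‖ < ε) ∧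
      (∀ᶠ z in 𝓝[ball 0 1] ζ₁, z ∈ K) ∧ ∀ᶠ z in 𝓝[ball 0 1] ζ₂, z ∈ K) : ζ₁ = ζ₂ := by
  by_contra hne
  -- Directions whose line through 0 strictly separates `ζ₁` from `ζ₂`; the perpendicular to the
  -- chord is one of them.
  set A : Set ℂ := {x | ((starRingEnd ℂ) x * ζ₁).im * ((starRingEnd ℂ) x * ζ₂).im < 0} with hA
  have hAo : IsOpen A := isOpen_lt (by fun_prop) continuous_const
  refine hβ 0 (mem_ball_self one_pos) (eq_of_eq_on_open_directions hc hd hAo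
    (ξ₀ := Complex.I * (ζ₁ - ζ₂) / (‖ζ₁ - ζ₂‖ : ℂ)) ?_ ?_ ?_)
  · have : ‖ζ₁ - ζ₂‖ ≠ 0 := norm_ne_zero_iff.2 (sub_ne_zero.2 hne)
    simp [this]
  · have hp : 0 < ‖ζ₁ - ζ₂‖ := norm_pos_iff.2 (sub_ne_zero.2 hne)
    have e1 : ζ₁.re * ζ₁.re + ζ₁.im * ζ₁.im = 1 := by
      rw [← Complex.normSq_apply, Complex.normSq_eq_norm_sq, h₁, one_pow]
    have e2 : ζ₂.re * ζ₂.re + ζ₂.im * ζ₂.im = 1 := by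
      rw [← Complex.normSq_apply, Complex.normSq_eq_norm_sq, h₂, one_pow]
    have e3 : ‖ζ₁ - ζ₂‖ ^ 2 = 2 - 2 * (ζ₁.re * ζ₂.re + ζ₁.im * ζ₂.im) := by
      rw [Complex.sq_norm, Complex.normSq_apply]
      simp
      linarith
    set N := ‖ζ₁ - ζ₂‖
    have e4 : (starRingEnd ℂ) (Complex.I * (ζ₁ - ζ₂) / (N : ℂ))
        = ((N⁻¹ : ℝ) : ℂ) * (-Complex.I * (starRingEnd ℂ) (ζ₁ - ζ₂)) := by
      simp
      field_simp
    rw [hA, Set.mem_ofPred_eq, e4, mul_assoc, mul_assoc (_ : ℂ) _ ζ₂, Complex.im_ofReal_mul, Complex.im_ofReal_mul]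
    have f1 : (-Complex.I * (starRingEnd ℂ) (ζ₁ - ζ₂) * ζ₁).im = -(N ^ 2 / 2) := by
      rw [e3]
      simp
      linarith
    have f2 : (-Complex.I * (starRingEnd ℂ) (ζ₁ - ζ₂) * ζ₂).im = N ^ 2 / 2 := by
      rw [e3]
      simp
      linarith
    rw [f1, f2]
    have : 0 < N⁻¹ * (N ^ 2 / 2) := by positivity
    nlinarith
  · intro ξ hξA hξ
    have hξA' : ((starRingEnd ℂ) ξ * ζ₁).im * ((starRingEnd ℂ) ξ * ζ₂).im < 0 := hξA
    have hmaps : MapsTo (fun t : ℝ => (t : ℂ) * ξ) (Icc (-1) 1) (closedBall 0 1) := fun t ht => by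
      simpa [hξ] using abs_le.2 ht
    have hcont : ContinuousOn (fun t : ℝ => ‖G (t * ξ) - β‖) (Icc (-1) 1) :=
      ((hc.comp (by fun_prop) hmaps).sub continuousOn_const).norm
    obtain ⟨t₀, ht₀, hmin⟩ := isCompact_Icc.exists_isMinOn
      (nonempty_Icc.2 (by norm_num)) hcont
    -- `K` comes near both `ζ₁` and `ζ₂`, so it crosses the diameter. The minimum of `|G - β|` there
    -- is thus 0, and since `β` is omitted inside, it is attained at an end point.
    have hle : ∀ ε > 0, ‖G (t₀ * ξ) - β‖ < ε := by
      intro ε hε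
      obtain ⟨K, hKb, hKc, hKε, hK1, hK2⟩ := hK ε hε
      set L : ℂ → ℝ := fun z => ((starRingEnd ℂ) ξ * z).im with hL
      have hLc : Continuous L := by fun_prop
      have n1 := IsConvexMapping.nhdsWithin_ball_neBot h₁.le
      have n2 := IsConvexMapping.nhdsWithin_ball_neBot h₂.le
      obtain ⟨z, hzK, hz0⟩ : ∃ z ∈ K, L z = 0 := by
        rcases mul_neg_iff.1 hξA' with ⟨hp, hn⟩ | ⟨hn, hp⟩
        · obtain ⟨x, hxK, hx⟩ := (hK1.and ((hLc.continuousAt.eventually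
            (lt_mem_nhds hp)).filter_mono nhdsWithin_le_nhds)).exists
          obtain ⟨y, hyK, hy⟩ := (hK2.and ((hLc.continuousAt.eventually
            (gt_mem_nhds hn)).filter_mono nhdsWithin_le_nhds)).exists
          exact hKc.intermediate_value hyK hxK hLc.continuousOn ⟨hy.le, hx.le⟩
        · obtain ⟨x, hxK, hx⟩ := (hK1.and ((hLc.continuousAt.eventually
            (gt_mem_nhds hn)).filter_mono nhdsWithin_le_nhds)).exists
          obtain ⟨y, hyK, hy⟩ := (hK2.and ((hLc.continuousAt.eventually
            (lt_mem_nhds hp)).filter_mono nhdsWithin_le_nhds)).exists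
          exact hKc.intermediate_value hxK hyK hLc.continuousOn ⟨hx.le, hy.le⟩
      have hzξ : z = ((((starRingEnd ℂ) ξ * z).re : ℝ) : ℂ) * ξ := by
        have e1 : (starRingEnd ℂ) ξ * z = (((starRingEnd ℂ) ξ * z).re : ℂ) :=
          Complex.ext rfl (by rw [Complex.ofReal_im]; exact hz0)
        rw [← e1, mul_right_comm, mul_comm ((starRingEnd ℂ) ξ), Complex.mul_conj,
          Complex.normSq_eq_norm_sq, hξ]
        simp
      set t := ((starRingEnd ℂ) ξ * z).re
      have htz : ‖z‖ = |t| := by rw [hzξ]; simp [hξ]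
      have hz1 : ‖z‖ < 1 := by simpa using hKb hzK
      have h3 := hmin (show t ∈ Icc (-1 : ℝ) 1 from abs_le.1 (htz ▸ hz1.le))
      have h4 := hKε z hzK
      rw [hzξ] at h4
      exact lt_of_le_of_lt h3 h4
    have hz : G (t₀ * ξ) = β := by
      have h5 : ‖G (t₀ * ξ) - β‖ ≤ 0 := le_of_forall_pos_lt_add fun ε hε => by
        simpa using hle ε hε
      exact sub_eq_zero.1 (norm_le_zero_iff.1 h5)
    have ht1 : |t₀| = 1 := by
      refine le_antisymm (abs_le.2 ht₀) (not_lt.1 fun hlt => hβ _ ?_ hz)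
      simpa [hξ] using hlt
    rcases eq_or_eq_neg_of_abs_eq ht1 with h6 | h6
    · left
      simpa [h6] using hz
    · right
      simpa [h6] using hz

end BoundaryUniqueness

/-! ### Boundary behaviour of `f` read off from `f*` -/

namespace IsConvexMapping

open Metric Set Bornology

variable {f : ℂ → ℂ}

theorem one_sub_mul_fStar (hf : IsConvexMapping f) {z : ℂ} (hz : ‖z‖ < 1) :
    1 - secondCoeff f * fStar f z = (1 + secondCoeff f * f z)⁻¹ := by
  have := hf.one_add_ne_zero hz
  rw [fStar]
  field_simp
  ring

theorem eq_fStar_div (hf : IsConvexMapping f) {z : ℂ} (hz : ‖z‖ < 1) :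
    f z = fStar f z / (1 - secondCoeff f * fStar f z) := by
  rw [hf.one_sub_mul_fStar hz, div_inv_eq_mul, fStar, div_mul_cancel₀ _ (hf.one_add_ne_zero hz)]

theorem tendsto_cobounded_of_fStarExt (hf : IsConvexMapping f) (ha : secondCoeff f ≠ 0) {ζ : ℂ}
    (hζ : ‖ζ‖ = 1) (h : secondCoeff f * fStarExt f ζ = 1) :
    Tendsto f (𝓝[ball 0 1] ζ) (cobounded ℂ) := by
  have h1 := (hf.tendsto_fStarExt ha hζ).const_mul (secondCoeff f)
  rw [h] at h1
  have h2 : Tendsto (fun z => (1 + secondCoeff f * f z)⁻¹) (𝓝[ball 0 1] ζ) (𝓝[≠] 0) := by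
    refine tendsto_nhdsWithin_iff.2 ⟨?_, ?_⟩
    · have h3 := h1.const_sub 1
      rw [sub_self] at h3
      refine h3.congr' ?_
      filter_upwards [self_mem_nhdsWithin] with z hz
      exact hf.one_sub_mul_fStar (by simpa using hz)
    · filter_upwards [self_mem_nhdsWithin] with z hz
      exact inv_ne_zero (hf.one_add_ne_zero (by simpa using hz))
  have h3 := tendsto_inv₀_nhdsNE_zero.comp h2
  rw [← tendsto_norm_atTop_iff_cobounded] at h3 ⊢
  refine tendsto_atTop_mono (fun z => ?_)
    ((tendsto_atTop_add_const_right _ (-1) h3).atTop_div_const (norm_pos_iff.2 ha))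
  simp only [Function.comp_apply, inv_inv]
  rw [div_le_iff₀ (norm_pos_iff.2 ha), ← norm_mul, mul_comm (f z)]
  have := norm_add_le (1 : ℂ) (secondCoeff f * f z)
  rw [norm_one] at this
  linarith

theorem tendsto_of_fStarExt (hf : IsConvexMapping f) (ha : secondCoeff f ≠ 0) {ζ : ℂ}
    (hζ : ‖ζ‖ = 1) (h : secondCoeff f * fStarExt f ζ ≠ 1) :
    Tendsto f (𝓝[ball 0 1] ζ) (𝓝 (fStarExt f ζ / (1 - secondCoeff f * fStarExt f ζ))) := by
  have h1 := hf.tendsto_fStarExt ha hζ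
  refine (h1.div ((h1.const_mul _).const_sub 1) (sub_ne_zero.2 h.symm)).congr' ?_
  filter_upwards [self_mem_nhdsWithin] with z hz
  exact (hf.eq_fStar_div (by simpa using hz)).symm

theorem fStarExt_of_tendsto_cobounded (hf : IsConvexMapping f) (ha : secondCoeff f ≠ 0) {ζ : ℂ}
    (hζ : ‖ζ‖ = 1) {l : Filter ℂ} [l.NeBot] (hl : l ≤ 𝓝[ball 0 1] ζ)
    (h : Tendsto f l (cobounded ℂ)) : secondCoeff f * fStarExt f ζ = 1 := by
  by_contra hne
  exact (hf.tendsto_of_fStarExt ha hζ hne).mono_left hl |>.not_tendsto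
    (disjoint_nhds_cobounded _) h

/-- The limits of `f` on the unit circle at which `|a₂ f*| = 1` are the zeros of the tangent plane
of the conformal radius. -/
theorem norm_fStarExt_eq_one_iff (hf : IsConvexMapping f) (ha : secondCoeff f ≠ 0) {ζ w : ℂ}
    (hζ : ‖ζ‖ = 1) (h : Tendsto f (𝓝[ball 0 1] ζ) (𝓝 w)) :
    ‖secondCoeff f * fStarExt f ζ‖ = 1 ↔ 1 + 2 * (secondCoeff f * w).re = 0 := by
  have := nhdsWithin_ball_neBot hζ.le
  have hne : secondCoeff f * fStarExt f ζ ≠ 1 := fun h1 =>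
    h.not_tendsto (disjoint_nhds_cobounded _) (hf.tendsto_cobounded_of_fStarExt ha hζ h1)
  have hw := tendsto_nhds_unique h (hf.tendsto_of_fStarExt ha hζ hne)
  set b := fStarExt f ζ
  have hne' : 1 - secondCoeff f * b ≠ 0 := sub_ne_zero.2 hne.symm
  have e1 : 1 + secondCoeff f * w = (1 - secondCoeff f * b)⁻¹ := by
    rw [hw]
    field_simp
    ring
  have e2 : secondCoeff f * w = secondCoeff f * b * (1 - secondCoeff f * b)⁻¹ := by
    rw [hw]
    field_simp
  have h1 := norm_sq_one_add_sub_norm_sq (secondCoeff f * w)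
  rw [← h1, e1, e2, norm_mul _ (_⁻¹), mul_pow, ← one_sub_mul, mul_eq_zero,
    or_iff_left (pow_ne_zero 2 (norm_ne_zero_iff.2 (inv_ne_zero hne'))), sub_eq_zero,
    eq_comm (a := (1 : ℝ)), pow_eq_one_iff_of_nonneg (norm_nonneg _) two_ne_zero]

/-- Continuity of the inverse at `w` would force `ζ` to lie in the open disk. -/
theorem not_mem_image_of_tendsto (hf : IsConvexMapping f) {ζ w : ℂ} (hζ : ‖ζ‖ = 1)
    {l : Filter ℂ} [l.NeBot] (hl : l ≤ 𝓝[ball 0 1] ζ)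
    (h : Tendsto f l (𝓝 w)) : w ∉ f '' ball 0 1 := by
  rintro ⟨z, hz, rfl⟩
  have h1 := (continuousAt_invFunOn isOpen_ball hf.differentiableOn hf.injOn hz).tendsto.comp h
  rw [hf.injOn.leftInvOn_invFunOn hz] at h1
  have h2 : Tendsto (Function.invFunOn f (ball 0 1) ∘ f) l (𝓝 ζ) := by
    refine Tendsto.congr' ?_ (tendsto_id.mono_left (hl.trans nhdsWithin_le_nhds))
    filter_upwards [hl self_mem_nhdsWithin] with x hx
    exact (hf.injOn.leftInvOn_invFunOn hx).symm
  have h3 := tendsto_nhds_unique h1 h2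
  rw [h3] at hz
  simp [hζ] at hz

theorem mem_closure_of_tendsto_ball {ζ w : ℂ} (hζ : ‖ζ‖ = 1)
    (h : Tendsto f (𝓝[ball 0 1] ζ) (𝓝 w)) : w ∈ closure (f '' ball 0 1) := by
  have := nhdsWithin_ball_neBot hζ.le
  refine mem_closure_of_tendsto h ?_
  filter_upwards [self_mem_nhdsWithin] with z hz using mem_image_of_mem f hz

/-- A sequence in the disk along which `f` leaves every compact subset of its image has a
subsequence converging to a point of the unit circle. -/
theorem exists_subseq_tendsto_circle {z : ℕ → ℂ}
    (hz : ∀ n, ‖z n‖ < 1) (h : ∀ x : ℂ, ‖x‖ < 1 → ∀ φ : ℕ → ℕ, StrictMono φ →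
      ¬ Tendsto (z ∘ φ) atTop (𝓝 x)) :
    ∃ ζ : ℂ, ‖ζ‖ = 1 ∧ ∃ φ : ℕ → ℕ, StrictMono φ ∧ Tendsto (z ∘ φ) atTop (𝓝[ball 0 1] ζ) := by
  obtain ⟨ζ, hζ, φ, hφ, hlim⟩ := (isCompact_closedBall (0 : ℂ) 1).tendsto_subseq
    (x := z) fun n => by simpa using (hz n).le
  refine ⟨ζ, ?_, φ, hφ, tendsto_nhdsWithin_iff.2 ⟨hlim, .of_forall fun n => by
    simpa using hz (φ n)⟩⟩
  exact le_antisymm (by simpa using hζ) (not_lt.1 fun hlt => h ζ hlt φ hφ hlim)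

theorem exists_tendsto_cobounded (hf : IsConvexMapping f) (ha : secondCoeff f ≠ 0) {z : ℕ → ℂ}
    (hz : ∀ n, ‖z n‖ < 1) (h : Tendsto (f ∘ z) atTop (cobounded ℂ)) :
    ∃ ζ : ℂ, ‖ζ‖ = 1 ∧ secondCoeff f * fStarExt f ζ = 1 ∧
      ∃ φ : ℕ → ℕ, StrictMono φ ∧ Tendsto (z ∘ φ) atTop (𝓝[ball 0 1] ζ) := by
  obtain ⟨ζ, hζ, φ, hφ, hlim⟩ := exists_subseq_tendsto_circle hz fun x hx φ hφ hlim =>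
    ((hf.differentiableAt hx).continuousAt.tendsto.comp hlim).not_tendsto
      (disjoint_nhds_cobounded _) (h.comp hφ.tendsto_atTop)
  exact ⟨ζ, hζ, hf.fStarExt_of_tendsto_cobounded ha hζ hlim
    (tendsto_map'_iff.2 (h.comp hφ.tendsto_atTop)), φ, hφ, hlim⟩

/-- Preimages of a sequence tending to `w` accumulate at the circle. As `f` has a full limit there,
finite or infinite, the limit along the subsequence determines it. -/
theorem exists_tendsto_of_mem_closure (hf : IsConvexMapping f) (ha : secondCoeff f ≠ 0) {w : ℂ}
    (hw : w ∈ closure (f '' ball 0 1)) (hw' : w ∉ f '' ball 0 1) :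
    ∃ ζ : ℂ, ‖ζ‖ = 1 ∧ Tendsto f (𝓝[ball 0 1] ζ) (𝓝 w) := by
  obtain ⟨y, hy, hyw⟩ := mem_closure_iff_seq_limit.1 hw
  choose z hz hzy using hy
  have hz' : ∀ n, ‖z n‖ < 1 := fun n => by simpa using hz n
  have hfz : Tendsto (f ∘ z) atTop (𝓝 w) := by
    convert hyw using 1
    exact funext hzy
  obtain ⟨ζ, hζ, φ, hφ, hlim⟩ := exists_subseq_tendsto_circle hz' fun x hx φ hφ hlim => hw' <| by
    rw [tendsto_nhds_unique (hfz.comp hφ.tendsto_atTop)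
      ((hf.differentiableAt hx).continuousAt.tendsto.comp hlim)]
    exact mem_image f hx
  refine ⟨ζ, hζ, ?_⟩
  have h1 := hfz.comp hφ.tendsto_atTop
  have hne : secondCoeff f * fStarExt f ζ ≠ 1 := fun h2 => h1.not_tendsto
    (disjoint_nhds_cobounded _) ((hf.tendsto_cobounded_of_fStarExt ha hζ h2).comp hlim)
  have h3 := hf.tendsto_of_fStarExt ha hζ hne
  rwa [tendsto_nhds_unique (h3.comp hlim) h1] at h3

/-- Distinct points of the unit circle with the same value of `f*`, of modulus `1 / |a₂|`, cannot be
joined inside the preimages of small convex sets. -/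
theorem eq_of_convex_nhds (hf : IsConvexMapping f) (ha : secondCoeff f ≠ 0) {β ζ₁ ζ₂ : ℂ}
    (hβ : ‖secondCoeff f * β‖ = 1) (h₁ : ‖ζ₁‖ = 1) (h₂ : ‖ζ₂‖ = 1)
    (hS : ∀ U ∈ 𝓝 β, ∃ S : Set ℂ, Convex ℝ S ∧ (∀ z : ℂ, ‖z‖ < 1 → f z ∈ S → fStar f z ∈ U) ∧
      (∀ᶠ z in 𝓝[ball 0 1] ζ₁, f z ∈ S) ∧ ∀ᶠ z in 𝓝[ball 0 1] ζ₂, f z ∈ S) : ζ₁ = ζ₂ := by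
  refine eq_of_isPreconnected_sublevel (β := β) (hf.continuousOn_fStarExt ha) ?_ ?_ h₁ h₂ ?_
  · intro z hz
    refine ((hf.hasDerivAt_fStar (by simpa using hz)).differentiableAt.congr_of_eventuallyEq
      ?_).differentiableWithinAt
    exact hf.eqOn_fStarExt.eventuallyEq_of_mem (isOpen_ball.mem_nhds hz)
  · intro z hz h
    rw [hf.eqOn_fStarExt hz] at h
    have := hf.norm_mul_fStar_lt_one (z := z) (by simpa using hz)
    rw [h, hβ] at this
    exact lt_irrefl _ this
  · intro ε hε
    obtain ⟨S, hSc, hSε, hS1, hS2⟩ := hS _ (ball_mem_nhds β hε)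
    refine ⟨ball 0 1 ∩ f ⁻¹' S, inter_subset_left, ?_, ?_, ?_, ?_⟩
    -- Connectedness comes from convexity: the set is the image of the convex set `f(𝔻) ∩ S` under
    -- the continuous inverse.
    · have e : ball 0 1 ∩ f ⁻¹' S = Function.invFunOn f (ball 0 1) '' (f '' ball 0 1 ∩ S) := by
        ext z
        constructor
        · rintro ⟨hz, hzS⟩
          exact ⟨f z, ⟨mem_image_of_mem f hz, hzS⟩, hf.injOn.leftInvOn_invFunOn hz⟩
        · rintro ⟨_, ⟨⟨x, hx, rfl⟩, hxS⟩, rfl⟩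
          rw [hf.injOn.leftInvOn_invFunOn hx]
          exact ⟨hx, hxS⟩
      rw [e]
      exact (hf.convex_image.inter hSc).isPreconnected.image _
        ((differentiableOn_invFunOn isOpen_ball hf.differentiableOn
          hf.injOn).continuousOn.mono inter_subset_left)
    · rintro z ⟨hz, hzS⟩
      rw [hf.eqOn_fStarExt hz, ← dist_eq_norm]
      exact hSε z (by simpa using hz) hzS
    · filter_upwards [self_mem_nhdsWithin, hS1] with z hz hzS using ⟨hz, hzS⟩
    · filter_upwards [self_mem_nhdsWithin, hS2] with z hz hzS using ⟨hz, hzS⟩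

/-- The case `β = 1/a`, the limit of `w / (1 + a w)` at infinity. -/
theorem eq_of_convex_nhds_cobounded (hf : IsConvexMapping f) (ha : secondCoeff f ≠ 0) {ζ₁ ζ₂ : ℂ}
    (h₁ : ‖ζ₁‖ = 1) (h₂ : ‖ζ₂‖ = 1)
    (hS : ∀ N : ℝ, ∃ S : Set ℂ, Convex ℝ S ∧ (∀ w ∈ S, N ≤ ‖w‖) ∧
      (∀ᶠ z in 𝓝[ball 0 1] ζ₁, f z ∈ S) ∧ ∀ᶠ z in 𝓝[ball 0 1] ζ₂, f z ∈ S) : ζ₁ = ζ₂ := by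
  refine hf.eq_of_convex_nhds ha (β := (secondCoeff f)⁻¹) (by simp [ha]) h₁ h₂ fun U hU => ?_
  have h1 : Tendsto (fun w : ℂ => w / (1 + secondCoeff f * w)) (cobounded ℂ)
      (𝓝 (secondCoeff f)⁻¹) := by
    have h2 : Tendsto (fun w : ℂ => (w⁻¹ + secondCoeff f)⁻¹) (cobounded ℂ)
        (𝓝 (0 + secondCoeff f)⁻¹) :=
      (tendsto_inv₀_cobounded.add_const _).inv₀ (by simpa using ha)
    rw [zero_add] at h2
    refine h2.congr' ?_
    filter_upwards [eventually_ne_cobounded (0 : ℂ)] with w hw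
    rw [← one_div, div_eq_div_iff_comm, eq_comm]
    field_simp
  obtain ⟨N, -, hN⟩ := hasBasis_cobounded_norm.eventually_iff.1 (h1.eventually hU)
  obtain ⟨S, hSc, hSN, hS1, hS2⟩ := hS N
  exact ⟨S, hSc, fun z _ hzS => hN (hSN _ hzS), hS1, hS2⟩

/-- On the zero line of the plane `|a w| = |1 + a w|`, so the common value of `f*` has the critical
modulus; small disks about `w` serve as convex sets. -/
theorem eq_of_tendsto_nhds (hf : IsConvexMapping f) (ha : secondCoeff f ≠ 0) {ζ₁ ζ₂ w : ℂ}
    (h₁ : ‖ζ₁‖ = 1) (h₂ : ‖ζ₂‖ = 1) (hw : 1 + 2 * (secondCoeff f * w).re = 0)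
    (ht₁ : Tendsto f (𝓝[ball 0 1] ζ₁) (𝓝 w)) (ht₂ : Tendsto f (𝓝[ball 0 1] ζ₂) (𝓝 w)) :
    ζ₁ = ζ₂ := by
  have hx := norm_sq_one_add_sub_norm_sq (secondCoeff f * w)
  have hne : 1 + secondCoeff f * w ≠ 0 := fun h => by
    rw [h, hw, norm_zero] at hx
    have h0 : secondCoeff f * w = 0 := by
      rw [← norm_eq_zero, ← pow_eq_zero_iff two_ne_zero]
      linarith
    rw [h0] at h
    simp at h
  have hx' : ‖secondCoeff f * w‖ = ‖1 + secondCoeff f * w‖ := by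
    rw [hw] at hx
    exact (sq_eq_sq₀ (norm_nonneg _) (norm_nonneg _)).1 (by linarith)
  refine hf.eq_of_convex_nhds ha (β := w / (1 + secondCoeff f * w)) ?_ h₁ h₂ fun U hU => ?_
  · rw [← mul_div_assoc, norm_div, hx', div_self (norm_ne_zero_iff.2 hne)]
  · have h1 : ContinuousAt (fun w : ℂ => w / (1 + secondCoeff f * w)) w :=
      continuousAt_id.div (by fun_prop) hne
    obtain ⟨δ, hδ, hball⟩ := Metric.mem_nhds_iff.1 (h1 hU)
    exact ⟨ball w δ, convex_ball _ _, fun z _ hzS => hball hzS,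
      ht₁ (ball_mem_nhds w hδ), ht₂ (ball_mem_nhds w hδ)⟩

/-! ### Contact with the tangent plane and symmetries of the image -/

open Bornology

theorem combo_mem_image (hf : IsConvexMapping f) {w v : ℂ} (hw : w ∈ f '' ball 0 1)
    (hv : v ∈ closure (f '' ball 0 1)) {t : ℝ} (h0 : 0 ≤ t) (h1 : t < 1) :
    (1 - t) * w + t * v ∈ f '' ball 0 1 := by
  have h := hf.convex_image.combo_interior_closure_mem_interior
    (by rwa [hf.isOpen_image.interior_eq]) hv (sub_pos.2 h1) h0 (by ring)
  rw [hf.isOpen_image.interior_eq] at h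
  simpa using h

theorem affine_pos (hf : IsConvexMapping f) {w : ℂ} (hw : w ∈ f '' ball 0 1) :
    0 < 1 + 2 * (secondCoeff f * w).re := by
  obtain ⟨z, hz, rfl⟩ := hw
  exact hf.one_add_two_mul_re_pos (by simpa using hz)

theorem affine_nonneg (hf : IsConvexMapping f) {w : ℂ} (hw : w ∈ closure (f '' ball 0 1)) :
    0 ≤ 1 + 2 * (secondCoeff f * w).re := by
  have hcl : IsClosed {w : ℂ | 0 ≤ 1 + 2 * (secondCoeff f * w).re} :=
    isClosed_le continuous_const (by fun_prop)
  exact closure_minimal (fun w hw => (hf.affine_pos hw).le) hcl hw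

/-- A rescaled translate of `f` that stays in the image of `f` obeys the tangent plane bound at the
image of the origin, and fills the image of `f` in case of equality. -/
theorem le_affine_of_mapsTo (hf : IsConvexMapping f) {r : ℝ} (hr : 0 < r) {b : ℂ}
    (hm : ∀ w ∈ f '' ball 0 1, r * w + b ∈ f '' ball 0 1) :
    r ≤ 1 + 2 * (secondCoeff f * b).re ∧
      (1 + 2 * (secondCoeff f * b).re ≤ r → ∀ w ∈ f '' ball 0 1, (w - b) / r ∈ f '' ball 0 1) := by
  obtain ⟨z, hz, hzb⟩ : b ∈ f '' ball 0 1 := by simpa using hm 0 hf.zero_mem_image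
  have hz1 : ‖z‖ < 1 := by simpa using hz
  have h := hf.norm_deriv_le_confRadius (h := fun x => r * f x + b) (z := z)
    ((hf.differentiableOn.const_mul _).add_const _)
    (fun x hx => hm _ (mem_image_of_mem f hx)) hz1 (by simp [hf.map_zero, hzb])
  have hd : deriv (fun x => (r : ℂ) * f x + b) 0 = r := by
    have := (((hf.differentiableAt (z := 0) (by simp)).hasDerivAt).const_mul (r : ℂ)).add_const b
    rw [this.deriv, hf.deriv_zero, mul_one]
  have hr0 : (r : ℂ) ≠ 0 := by exact_mod_cast hr.ne'
  rw [hd, Complex.norm_of_nonneg hr.le] at h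
  have hle := hf.confRadius_le hz1
  rw [hzb] at hle
  refine ⟨h.1.trans hle, fun h2 w hw => ?_⟩
  obtain ⟨x, hx, hxw⟩ := h.2 (hle.trans h2) hw
  refine ⟨x, hx, ?_⟩
  rw [← hxw]
  simp only
  field_simp
  ring

/-- A zero of the tangent plane in the closure of the image is a centre of dilations of the
image. -/
theorem dilation_of_affine_eq_zero (hf : IsConvexMapping f) {v : ℂ}
    (hv : v ∈ closure (f '' ball 0 1)) (h : 1 + 2 * (secondCoeff f * v).re = 0) :
    ∀ w ∈ f '' ball 0 1, ∀ r : ℝ, 0 < r → v + r * (w - v) ∈ f '' ball 0 1 := by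
  intro w hw r hr
  rcases le_or_gt r 1 with h1 | h1
  · have := hf.combo_mem_image hw hv (sub_nonneg.2 h1) (by linarith)
    convert this using 1
    push_cast
    ring
  · have hr0 : (r : ℂ) ≠ 0 := by exact_mod_cast hr.ne'
    have hi : r⁻¹ < 1 := inv_lt_one_of_one_lt₀ h1
    have hip : 0 < r⁻¹ := inv_pos.2 hr
    -- The contraction about `v` of ratio `r⁻¹` preserves the image, and at its translation part the
    -- plane equals exactly `r⁻¹`. Equality makes the contraction onto, and its inverse is the
    -- wanted expansion.
    have key := (hf.le_affine_of_mapsTo hip (b := ((1 - r⁻¹ : ℝ) : ℂ) * v) fun w hw => by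
      have := hf.combo_mem_image hw hv (t := 1 - r⁻¹) (by linarith) (by linarith)
      convert this using 2
      push_cast
      ring).2 ?_ w hw
    · convert key using 1
      push_cast
      field_simp
      ring
    · rw [mul_left_comm, Complex.re_ofReal_mul]
      nlinarith

/-- Doubling about `v` has translation part `-v`, so the bound reads `2 ≤ 1 - 2 Re(a v)`;
nonnegativity on the closure gives the converse inequality. -/
theorem affine_eq_zero_of_dilation (hf : IsConvexMapping f) {v : ℂ}
    (hv : v ∈ closure (f '' ball 0 1))
    (h : ∀ w ∈ f '' ball 0 1, ∀ r : ℝ, 0 < r → v + r * (w - v) ∈ f '' ball 0 1) :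
    1 + 2 * (secondCoeff f * v).re = 0 := by
  have h1 := (hf.le_affine_of_mapsTo two_pos (b := -v) fun w hw => by
    have := h w hw 2 two_pos
    convert this using 1
    push_cast
    ring).1
  have h2 := hf.affine_nonneg hv
  rw [mul_neg, Complex.neg_re] at h1
  linarith

/-- The point is the midpoint of an interior point and a point of the closure. -/
theorem add_mem_image_of_recession (hf : IsConvexMapping f) {e : ℂ}
    (he : ∀ w ∈ f '' ball 0 1, ∀ t : ℝ, 0 ≤ t → w + t * e ∈ closure (f '' ball 0 1)) :
    ∀ w ∈ f '' ball 0 1, ∀ t : ℝ, 0 ≤ t → w + t * e ∈ f '' ball 0 1 := by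
  intro w hw t ht
  have := hf.combo_mem_image hw (he w hw (2 * t) (by linarith)) (t := 1 / 2) (by norm_num)
    (by norm_num)
  convert this using 1
  push_cast
  ring

/-- Either the image of `f` is invariant under the translations in some direction, or the tangent
plane of the conformal radius tends to infinity at infinity on the image of `f`. -/
theorem exists_line_or_isBounded (hf : IsConvexMapping f) :
    (∃ e : ℂ, ‖e‖ = 1 ∧ ∀ w ∈ f '' ball 0 1, ∀ t : ℝ, w + t * e ∈ f '' ball 0 1) ∨
      ∀ M : ℝ, IsBounded {w ∈ f '' ball 0 1 | 1 + 2 * (secondCoeff f * w).re ≤ M} := by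
  refine or_iff_not_imp_right.2 fun hcon => ?_
  obtain ⟨M, hM⟩ := not_forall.1 hcon
  have hex : ∀ n : ℕ, ∃ w ∈ f '' ball 0 1, 1 + 2 * (secondCoeff f * w).re ≤ M ∧
      (n : ℝ) + 1 ≤ ‖w‖ := by
    intro n
    by_contra! hno
    exact hM (isBounded_iff_forall_norm_le.2 ⟨n + 1, fun w hw => (hno w hw.1 hw.2).le⟩)
  choose w hwΩ hwM hwn using hex
  have hpos : ∀ n, 0 < ‖w n‖ := fun n => lt_of_lt_of_le (by positivity) (hwn n)
  have hN : Tendsto (fun n => ‖w n‖) atTop atTop :=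
    tendsto_atTop_mono hwn (tendsto_atTop_add_const_right _ _ tendsto_natCast_atTop_atTop)
  -- A limit direction of points going to infinity with the plane bounded by `M`: it is a recession
  -- direction by convexity, and `Re(a e) ≤ 0`.
  obtain ⟨e, he, φ, hφ, hlim⟩ := (isCompact_sphere (0 : ℂ) 1).tendsto_subseq
    (x := fun n => w n / (‖w n‖ : ℂ)) fun n => by
      simp [(hpos n).ne']
  have he1 : ‖e‖ = 1 := by simpa using he
  have hNφ := hN.comp hφ.tendsto_atTop
  have hinv : Tendsto (fun n => ‖w (φ n)‖⁻¹) atTop (𝓝 0) := tendsto_inv_atTop_zero.comp hNφ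
  have hinvC : Tendsto (fun n => ((‖w (φ n)‖⁻¹ : ℝ) : ℂ)) atTop (𝓝 0) := by
    exact_mod_cast (Complex.continuous_ofReal.tendsto 0).comp hinv
  have hrec : ∀ x ∈ f '' ball 0 1, ∀ t : ℝ, 0 ≤ t → x + t * e ∈ closure (f '' ball 0 1) := by
    intro x hx t ht
    have hl : Tendsto (fun n => x - t * ((‖w (φ n)‖⁻¹ : ℝ) : ℂ) * x
        + t * (w (φ n) / (‖w (φ n)‖ : ℂ))) atTop (𝓝 (x - t * 0 * x + t * e)) :=
      ((hinvC.const_mul (t : ℂ)).mul_const x |>.const_sub x).add (hlim.const_mul (t : ℂ))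
    rw [mul_zero, zero_mul, sub_zero] at hl
    refine mem_closure_of_tendsto hl ?_
    filter_upwards [hNφ.eventually_gt_atTop t] with n hn
    have hn' : t < ‖w (φ n)‖ := hn
    have h1 : t * ‖w (φ n)‖⁻¹ < 1 := by
      rw [← div_eq_mul_inv, div_lt_one (hpos _)]
      exact hn'
    have h2 := hf.combo_mem_image hx (subset_closure (hwΩ (φ n)))
      (mul_nonneg ht (inv_nonneg.2 (norm_nonneg _))) h1
    convert h2 using 1
    push_cast
    ring
  have hadd := hf.add_mem_image_of_recession hrec
  have hre : (secondCoeff f * e).re ≤ 0 := by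
    have h1 : Tendsto (fun n => (secondCoeff f * (w (φ n) / (‖w (φ n)‖ : ℂ))).re) atTop
        (𝓝 (secondCoeff f * e).re) :=
      (Complex.continuous_re.tendsto _).comp (hlim.const_mul _)
    have h2 : Tendsto (fun n => (M - 1) / 2 * ‖w (φ n)‖⁻¹) atTop (𝓝 ((M - 1) / 2 * 0)) :=
      hinv.const_mul _
    rw [mul_zero] at h2
    refine le_of_tendsto_of_tendsto h1 h2 (.of_forall fun n => ?_)
    have h3 : secondCoeff f * (w (φ n) / (‖w (φ n)‖ : ℂ))
        = ((‖w (φ n)‖⁻¹ : ℝ) : ℂ) * (secondCoeff f * w (φ n)) := by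
      push_cast
      ring
    simp only
    rw [h3, Complex.re_ofReal_mul, mul_comm]
    refine mul_le_mul_of_nonneg_right ?_ (inv_nonneg.2 (norm_nonneg _))
    linarith [hwM (φ n)]
  refine ⟨e, he1, fun x hx t => ?_⟩
  rcases le_or_gt 0 t with ht | ht
  · exact hadd x hx t ht
  -- For the translation by `-t e` the scale is 1 and the plane is at most 1 at `-t e`. Equality
  -- holds, so the translation is onto and can be reversed.
  · have key := (hf.le_affine_of_mapsTo one_pos (b := ((-t : ℝ) : ℂ) * e) fun w hw => by
      simpa using hadd w hw (-t) (by linarith)).2 ?_ x hx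
    · convert key using 1
      push_cast
      ring
    · rw [mul_left_comm, Complex.re_ofReal_mul]
      nlinarith

end IsConvexMapping

/-! ### Strips, half-planes and sectors from their symmetries -/

section Classification

open Set

theorem csInf_lt_of_isOpen {s : Set ℝ} (ho : IsOpen s) (hb : BddBelow s) {x : ℝ} (hx : x ∈ s) :
    sInf s < x := by
  obtain ⟨y, hy, hyx⟩ := Metric.mem_nhds_iff.1 (ho.mem_nhds hx)
  refine (csInf_le hb (hyx (show x - y / 2 ∈ Metric.ball x y from ?_))).trans_lt (by linarith)
  rw [Metric.mem_ball, Real.dist_eq, abs_lt]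
  constructor <;> linarith

theorem lt_csSup_of_isOpen {s : Set ℝ} (ho : IsOpen s) (hb : BddAbove s) {x : ℝ} (hx : x ∈ s) :
    x < sSup s := by
  obtain ⟨y, hy, hyx⟩ := Metric.mem_nhds_iff.1 (ho.mem_nhds hx)
  refine lt_of_lt_of_le (by linarith)
    (le_csSup hb (hyx (show x + y / 2 ∈ Metric.ball x y from ?_)))
  rw [Metric.mem_ball, Real.dist_eq, abs_lt]
  constructor <;> linarith

theorem eq_Ioo_of_isOpen_isConnected {s : Set ℝ} (ho : IsOpen s) (hc : IsConnected s)
    (hb : BddBelow s) (ha : BddAbove s) : s = Ioo (sInf s) (sSup s) :=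
  Subset.antisymm (fun _ hx => ⟨csInf_lt_of_isOpen ho hb hx, lt_csSup_of_isOpen ho ha hx⟩)
    (hc.Ioo_csInf_csSup_subset hb ha)

theorem eq_Ioi_of_isOpen_isPreconnected {s : Set ℝ} (ho : IsOpen s) (hc : IsPreconnected s)
    (hb : BddBelow s) (ha : ¬BddAbove s) : s = Ioi (sInf s) :=
  Subset.antisymm (fun _ hx => csInf_lt_of_isOpen ho hb hx) (hc.Ioi_csInf_subset hb ha)

theorem eq_Iio_of_isOpen_isPreconnected {s : Set ℝ} (ho : IsOpen s) (hc : IsPreconnected s)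
    (hb : ¬BddBelow s) (ha : BddAbove s) : s = Iio (sSup s) :=
  Subset.antisymm (fun _ hx => lt_csSup_of_isOpen ho ha hx) (hc.Iio_csSup_subset hb ha)

variable {Ω : Set ℂ}

/-- A convex open set that is invariant under the translations in a direction and lies in a
half-plane is a strip or a half-plane. -/
theorem isParallelStrip_or_isHalfPlane_of_line (ho : IsOpen Ω) (hc : Convex ℝ Ω)
    (hne : Ω.Nonempty) {e a : ℂ} (he : ‖e‖ = 1) (ha : a ≠ 0)
    (hline : ∀ w ∈ Ω, ∀ t : ℝ, w + t * e ∈ Ω) (hpos : ∀ w ∈ Ω, 0 < 1 + 2 * (a * w).re) :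
    IsParallelStrip Ω ∨ IsHalfPlane Ω := by
  have he0 : e ≠ 0 := by
    rintro rfl
    simp at he
  have hee : (starRingEnd ℂ) e * e = 1 := by
    rw [mul_comm, Complex.mul_conj, Complex.normSq_eq_norm_sq, he]
    simp
  obtain ⟨w₀, hw₀⟩ := hne
  -- An affine function positive along a whole line is constant on it.
  have hae : (a * e).re = 0 := by
    by_contra hx
    have h1 := hpos _ (hline w₀ hw₀ (-(1 + 2 * (a * w₀).re) / (2 * (a * e).re)))
    rw [mul_add, mul_left_comm, Complex.add_re, Complex.re_ofReal_mul, div_mul_eq_mul_div,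
      mul_div_mul_right _ _ hx] at h1
    linarith
  set L : ℂ → ℝ := fun w => ((starRingEnd ℂ) e * w).im with hL
  have hLc : Continuous L := by fun_prop
  set I : Set ℝ := L '' Ω with hI
  have hΩI : ∀ w, w ∈ Ω ↔ L w ∈ I := by
    refine fun w => ⟨fun hw => ⟨w, hw, rfl⟩, ?_⟩
    rintro ⟨w', hw', h⟩
    have h1 := hline w' hw' ((starRingEnd ℂ) e * (w - w')).re
    have h2 : ((((starRingEnd ℂ) e * (w - w')).re : ℝ) : ℂ) = (starRingEnd ℂ) e * (w - w') := by
      refine Complex.ext (Complex.ofReal_re _) ?_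
      rw [Complex.ofReal_im, mul_sub, Complex.sub_im]
      exact (sub_eq_zero.2 h.symm).symm
    rw [h2] at h1
    convert h1 using 1
    linear_combination (w' - w) * hee
  have hIo : IsOpen I := by
    have : I = (fun y : ℝ => (Complex.I * y * e : ℂ)) ⁻¹' Ω := by
      ext y
      rw [mem_preimage, hΩI]
      have : L (Complex.I * y * e) = y := by
        simp only [hL]
        rw [mul_left_comm, hee]
        simp
      rw [this]
    rw [this]
    exact ho.preimage (by fun_prop)
  have hIc : IsConnected I :=
    ⟨⟨_, mem_image_of_mem L hw₀⟩, hc.isPreconnected.image _ hLc.continuousOn⟩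
  set κ := (a * e).im with hκ
  have hae' : a * e = κ * Complex.I := Complex.ext (by simp [hae]) (by simp [hκ])
  have hκ0 : κ ≠ 0 := by
    intro h
    rw [h] at hae'
    simp [ha, he0] at hae'
  have haL : ∀ w, (a * w).re = -κ * L w := by
    intro w
    have : a * w = κ * Complex.I * ((starRingEnd ℂ) e * w) := by
      rw [← hae']
      linear_combination (-(a * w)) * hee
    rw [this]
    simp [hL]
  by_cases hbb : BddBelow I
  · by_cases hba : BddAbove I
    · left
      have hIeq := eq_Ioo_of_isOpen_isConnected hIo hIc hbb hba
      have hlt : sInf I < sSup I := by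
        obtain ⟨y, hy⟩ := hIc.nonempty
        rw [hIeq] at hy
        exact hy.1.trans hy.2
      refine ⟨e, sInf I, sSup I, he0, hlt, ?_⟩
      ext w
      rw [hΩI]
      conv_lhs => rw [hIeq]
      exact Iff.rfl
    · right
      have hIeq := eq_Ioi_of_isOpen_isPreconnected hIo hIc.isPreconnected hbb hba
      refine ⟨Complex.I * e, sInf I, by simp [he0], ?_⟩
      ext w
      have : ((starRingEnd ℂ) (Complex.I * e) * w).re = L w := by
        simp [hL]
        ring
      rw [hΩI, halfPlane, Set.mem_ofPred_eq, this]
      conv_lhs => rw [hIeq]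
      exact Iff.rfl
  · by_cases hba : BddAbove I
    · right
      have hIeq := eq_Iio_of_isOpen_isPreconnected hIo hIc.isPreconnected hbb hba
      refine ⟨-(Complex.I * e), -sSup I, by simp [he0], ?_⟩
      ext w
      have : ((starRingEnd ℂ) (-(Complex.I * e)) * w).re = -L w := by
        simp [hL]
        ring
      rw [hΩI, halfPlane, Set.mem_ofPred_eq, this, neg_lt_neg_iff]
      conv_lhs => rw [hIeq]
      exact Iff.rfl
    · exfalso
      have hb : ∀ y ∈ I, κ * y < 1 / 2 := by
        rintro _ ⟨w, hw, rfl⟩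
        have := hpos w hw
        rw [haL] at this
        linarith
      rcases hκ0.lt_or_gt with hneg | hposκ
      · exact hbb ⟨1 / 2 / κ, fun y hy => by
          rw [div_le_iff_of_neg hneg, mul_comm]
          exact (hb y hy).le⟩
      · exact hba ⟨1 / 2 / κ, fun y hy => by
          rw [le_div_iff₀ hposκ, mul_comm]
          exact (hb y hy).le⟩

theorem arg_mul_exp_mul_I {x : ℂ} (hx : x ≠ 0) {θ : ℝ}
    (h : x.arg + θ ∈ Ioc (-Real.pi) Real.pi) :
    (x * Complex.exp (θ * Complex.I)).arg = x.arg + θ := by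
  rw [← Complex.arg_mul_cos_add_sin_mul_I (norm_pos_iff.2 hx) h, ← Complex.exp_mul_I]
  congr 1
  conv_lhs => rw [← Complex.norm_mul_exp_arg_mul_I x]
  rw [mul_assoc, ← Complex.exp_add]
  push_cast
  ring_nf

/-- A convex open cone that lies in a half-plane with the vertex on its boundary is a half-plane or
a sector. -/
theorem isHalfPlane_or_isSector_of_dilation (ho : IsOpen Ω) (hc : Convex ℝ Ω)
    (hne : Ω.Nonempty) {v a : ℂ} (ha : a ≠ 0)
    (hdil : ∀ w ∈ Ω, ∀ r : ℝ, 0 < r → v + r * (w - v) ∈ Ω)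
    (hpos : ∀ w ∈ Ω, 0 < (a * (w - v)).re) : IsHalfPlane Ω ∨ IsSector Ω := by
  have hpi := Real.pi_pos
  set X : ℂ → ℂ := fun w => a * (w - v) with hX
  set A : Set ℝ := (fun w => (X w).arg) '' Ω with hA
  have hX0 : ∀ w ∈ Ω, X w ≠ 0 := fun w hw h => by
    have := hpos w hw
    rw [show a * (w - v) = 0 from h] at this
    simp at this
  have hAsub : A ⊆ Ioo (-(Real.pi / 2)) (Real.pi / 2) := by
    rintro _ ⟨w, hw, rfl⟩
    exact abs_lt.1 (Complex.abs_arg_lt_pi_div_two_iff.2 (Or.inl (hpos w hw)))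
  have hmem : ∀ w w' : ℂ, w' ∈ Ω → X w ≠ 0 → (X w).arg = (X w').arg → w ∈ Ω := by
    intro w w' hw' hw h
    have h1 : 0 < ‖X w‖ / ‖X w'‖ := div_pos (norm_pos_iff.2 hw) (norm_pos_iff.2 (hX0 w' hw'))
    have h2 := hdil w' hw' _ h1
    convert h2 using 1
    have h3 := Complex.norm_mul_exp_arg_mul_I (X w)
    have h4 := Complex.norm_mul_exp_arg_mul_I (X w')
    rw [← h] at h4
    have h5 : (‖X w'‖ : ℂ) ≠ 0 := by exact_mod_cast norm_ne_zero_iff.2 (hX0 w' hw')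
    have h6 : X w = (‖X w‖ / ‖X w'‖ : ℝ) * X w' := by
      rw [Complex.ofReal_div, div_mul_eq_mul_div, eq_div_iff h5]
      linear_combination (‖X w'‖ : ℂ) * h3.symm - (‖X w‖ : ℂ) * h4.symm
    simp only [hX] at h6 ⊢
    apply mul_left_cancel₀ ha
    linear_combination h6
  have hΩA : ∀ w, w ∈ Ω ↔ X w ≠ 0 ∧ (X w).arg ∈ A := by
    refine fun w => ⟨fun hw => ⟨hX0 w hw, w, hw, rfl⟩, ?_⟩
    rintro ⟨hw, w', hw', h⟩
    exact hmem w w' hw' hw h.symm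
  have hAc : IsConnected A := by
    refine ⟨hne.image _, hc.isPreconnected.image _ fun w hw => ?_⟩
    refine ContinuousAt.continuousWithinAt ?_
    refine ContinuousAt.comp (g := Complex.arg) (f := X) (Complex.continuousAt_arg ?_) ?_
    · exact Complex.mem_slitPlane_iff.2 (Or.inl (hpos w hw))
    · exact Continuous.continuousAt (by fun_prop)
  have hAo : IsOpen A := by
    have : A = Ioo (-(Real.pi / 2)) (Real.pi / 2) ∩
        (fun θ : ℝ => v + Complex.exp (θ * Complex.I) / a) ⁻¹' Ω := by
      ext θ
      have hXθ : X (v + Complex.exp (θ * Complex.I) / a) = 1 * Complex.exp (θ * Complex.I) := by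
        simp only [hX]
        field_simp
        ring
      have harg : θ ∈ Ioo (-(Real.pi / 2)) (Real.pi / 2) →
          (X (v + Complex.exp (θ * Complex.I) / a)).arg = θ := fun hθ => by
        rw [hXθ, arg_mul_exp_mul_I one_ne_zero] <;> rw [Complex.arg_one, zero_add]
        exact ⟨by linarith [hθ.1], by linarith [hθ.2]⟩
      constructor
      · intro hθ
        refine ⟨hAsub hθ, ?_⟩
        rw [mem_preimage, hΩA, harg (hAsub hθ), hXθ]
        exact ⟨by simp, hθ⟩
      · rintro ⟨hθ, hθΩ⟩
        rw [← harg hθ]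
        exact ((hΩA _).1 hθΩ).2
    rw [this]
    exact isOpen_Ioo.inter (ho.preimage (by fun_prop))
  have hAeq := eq_Ioo_of_isOpen_isConnected hAo hAc (bddBelow_Ioo.mono hAsub)
    (bddAbove_Ioo.mono hAsub)
  set α := sInf A with hα
  set β := sSup A with hβ
  have hαβ : α < β := by
    obtain ⟨y, hy⟩ := hAc.nonempty
    rw [hAeq] at hy
    exact hy.1.trans hy.2
  have hα1 : -(Real.pi / 2) ≤ α := le_csInf hAc.nonempty fun y hy => (hAsub hy).1.le
  have hβ1 : β ≤ Real.pi / 2 := csSup_le hAc.nonempty fun y hy => (hAsub hy).2.le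
  -- The arguments lie in an interval of length `π`. If they fill it, the cone is a half-plane;
  -- otherwise it is a sector about the mean argument.
  rcases lt_or_ge (β - α) Real.pi with hlt | hge
  · right
    set m : ℝ := (α + β) / 2 with hm
    refine ⟨v, Complex.exp (m * Complex.I) / a, β - α,
      div_ne_zero (Complex.exp_ne_zero _) ha, by linarith, hlt, ?_⟩
    ext w
    have hdiv : (w - v) / (Complex.exp (m * Complex.I) / a)
        = X w * Complex.exp ((-m : ℝ) * Complex.I) := by
      simp only [hX]
      rw [Complex.ofReal_neg, neg_mul, Complex.exp_neg]
      field_simp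
    rw [hΩA, hAeq, sector, Set.mem_ofPred_eq, hdiv]
    have hXw : X w ≠ 0 ↔ w ≠ v := by simp [hX, ha, sub_eq_zero]
    rw [hXw]
    refine and_congr_right fun hw => ?_
    rw [← hXw] at hw
    constructor
    · rintro ⟨h1, h2⟩
      rw [arg_mul_exp_mul_I hw ⟨by linarith, by linarith⟩, abs_lt]
      constructor <;> linarith
    · intro h
      set y := X w * Complex.exp ((-m : ℝ) * Complex.I) with hy
      have hy0 : y ≠ 0 := mul_ne_zero hw (Complex.exp_ne_zero _)
      have hyX : X w = y * Complex.exp (m * Complex.I) := by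
        rw [hy, mul_assoc, ← Complex.exp_add]
        simp
      obtain ⟨h1, h2⟩ := abs_lt.1 h
      rw [hyX, arg_mul_exp_mul_I hy0 ⟨by linarith, by linarith⟩]
      constructor <;> linarith
  · left
    have hα2 : α = -(Real.pi / 2) := by linarith
    have hβ2 : β = Real.pi / 2 := by linarith
    refine ⟨(starRingEnd ℂ) a, (a * v).re, by simpa using ha, ?_⟩
    ext w
    rw [hΩA, hAeq, hα2, hβ2, mem_Ioo, ← abs_lt, Complex.abs_arg_lt_pi_div_two_iff, halfPlane,
      Set.mem_ofPred_eq, Complex.conj_conj]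
    have : (X w).re = (a * w).re - (a * v).re := by simp only [hX]; rw [mul_sub, Complex.sub_re]
    rw [← sub_pos (a := (a * w).re), ← this]
    constructor
    · rintro ⟨h1, h2⟩
      exact h2.resolve_right h1
    · intro h
      refine ⟨fun h0 => ?_, Or.inl h⟩
      rw [h0] at h
      simp at h

/-- A sector of opening angle less than `π` contains no line. -/
theorem sector_not_line {v u : ℂ} {α : ℝ} (hu : u ≠ 0) (hα : 0 < α) (hα' : α < Real.pi) {e : ℂ}
    (he : e ≠ 0) : ¬ ∀ t : ℝ, (t * e : ℂ) ∈ sector v u α := by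
  intro h
  set c := Real.cos (α / 2) with hc
  have hc0 : 0 < c := Real.cos_pos_of_mem_Ioo ⟨by linarith, by linarith⟩
  have key : ∀ t : ℝ, c * ‖(t * e - v) / u‖ ≤ ((t * e - v) / u).re := by
    intro t
    have h1 := (h t).2
    rw [← Complex.norm_mul_cos_arg ((t * e - v) / u), mul_comm]
    refine mul_le_mul_of_nonneg_left ?_ (norm_nonneg _)
    rw [← Real.cos_abs (Complex.arg _)]
    exact Real.cos_le_cos_of_nonneg_of_le_pi (abs_nonneg _) (by linarith) h1.le
  have hlow : ∀ t : ℝ, c * (|t| * ‖e / u‖ - ‖v / u‖) ≤ t * (e / u).re - (v / u).re := by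
    intro t
    have h1 := key t
    have h2 : (t * e - v) / u = t * (e / u) - v / u := by ring
    rw [h2, Complex.sub_re, Complex.re_ofReal_mul] at h1
    refine le_trans (mul_le_mul_of_nonneg_left ?_ hc0.le) h1
    have h3 := norm_sub_norm_le ((t : ℂ) * (e / u)) (v / u)
    rwa [norm_mul, Complex.norm_real, Real.norm_eq_abs] at h3
  have hp : 0 < ‖e / u‖ := norm_pos_iff.2 (div_ne_zero he hu)
  -- Adding the bounds at `t` and `-t` cancels the term linear in `t` on the right, while the left
  -- grows with `|t|`; beyond this threshold they contradict each other.
  obtain ⟨t, ht⟩ := exists_gt ((c * ‖v / u‖ + |(v / u).re|) / (c * ‖e / u‖))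
  have ht0 : 0 < t := lt_of_le_of_lt (by positivity) ht
  rw [div_lt_iff₀ (by positivity)] at ht
  have h1 := hlow t
  have h2 := hlow (-t)
  rw [abs_neg] at h2
  rw [abs_of_pos ht0] at h1 h2
  have h3 := neg_abs_le (v / u).re
  nlinarith

theorem sector_dilation {v u : ℂ} {α : ℝ} :
    ∀ w ∈ sector v u α, ∀ r : ℝ, 0 < r → v + r * (w - v) ∈ sector v u α := by
  rintro w ⟨hw, harg⟩ r hr
  have hr0 : (r : ℂ) ≠ 0 := by exact_mod_cast hr.ne'
  refine ⟨by simp [hr0, sub_eq_zero, hw], ?_⟩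
  rwa [show (v + r * (w - v) - v) / u = r * ((w - v) / u) by ring, Complex.arg_real_mul _ hr]

theorem halfPlane_dilation {u v : ℂ} {c : ℝ} (hv : ((starRingEnd ℂ) u * v).re = c) :
    ∀ w ∈ halfPlane u c, ∀ r : ℝ, 0 < r → v + r * (w - v) ∈ halfPlane u c := by
  intro w hw r hr
  have hw' : c < ((starRingEnd ℂ) u * w).re := hw
  rw [halfPlane, Set.mem_ofPred_eq, mul_add, Complex.add_re, hv, mul_left_comm,
    Complex.re_ofReal_mul, mul_sub, Complex.sub_re, hv]
  nlinarith

end Classification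

/-! ### Points of critical modulus in the four cases -/

namespace IsConvexMapping

open Metric Set Bornology

variable {f : ℂ → ℂ}

theorem tendsto_cobounded_or_dilation (hf : IsConvexMapping f) (ha : secondCoeff f ≠ 0) {ζ : ℂ}
    (hζ : ‖ζ‖ = 1) (h : ‖secondCoeff f * fStarExt f ζ‖ = 1) :
    Tendsto f (𝓝[ball 0 1] ζ) (cobounded ℂ) ∨
      ∃ w, Tendsto f (𝓝[ball 0 1] ζ) (𝓝 w) ∧ w ∉ f '' ball 0 1 ∧
        1 + 2 * (secondCoeff f * w).re = 0 ∧
        ∀ x ∈ f '' ball 0 1, ∀ r : ℝ, 0 < r → w + r * (x - w) ∈ f '' ball 0 1 := by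
  have := nhdsWithin_ball_neBot hζ.le
  by_cases h1 : secondCoeff f * fStarExt f ζ = 1
  · exact Or.inl (hf.tendsto_cobounded_of_fStarExt ha hζ h1)
  · right
    have h2 := hf.tendsto_of_fStarExt ha hζ h1
    have h3 := (hf.norm_fStarExt_eq_one_iff ha hζ h2).1 h
    exact ⟨_, h2, hf.not_mem_image_of_tendsto hζ le_rfl h2, h3,
      hf.dilation_of_affine_eq_zero (mem_closure_of_tendsto_ball hζ h2) h3⟩

theorem norm_fStarExt_of_tendsto_cobounded (hf : IsConvexMapping f) (ha : secondCoeff f ≠ 0)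
    {ζ : ℂ} (hζ : ‖ζ‖ = 1) (h : Tendsto f (𝓝[ball 0 1] ζ) (cobounded ℂ)) :
    ‖secondCoeff f * fStarExt f ζ‖ = 1 := by
  have := nhdsWithin_ball_neBot hζ.le
  rw [hf.fStarExt_of_tendsto_cobounded ha hζ le_rfl h, norm_one]

theorem exists_tendsto_cobounded_of_not_isBounded (hf : IsConvexMapping f)
    (ha : secondCoeff f ≠ 0) (hunb : ¬ IsBounded (f '' ball 0 1)) :
    ∃ ζ : ℂ, ‖ζ‖ = 1 ∧ Tendsto f (𝓝[ball 0 1] ζ) (cobounded ℂ) := by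
  have hex : ∀ n : ℕ, ∃ z : ℂ, ‖z‖ < 1 ∧ (n : ℝ) ≤ ‖f z‖ := by
    intro n
    by_contra! hno
    refine hunb (isBounded_iff_forall_norm_le.2 ⟨n, ?_⟩)
    rintro _ ⟨z, hz, rfl⟩
    exact (hno z (by simpa using hz)).le
  choose z hz hzn using hex
  obtain ⟨ζ, hζ, h, -⟩ := hf.exists_tendsto_cobounded ha hz (by
    rw [← tendsto_norm_atTop_iff_cobounded]
    exact tendsto_atTop_mono hzn tendsto_natCast_atTop_atTop)
  exact ⟨ζ, hζ, hf.tendsto_cobounded_of_fStarExt ha hζ h⟩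

/-- If the image contains no line, then `f` tends to infinity at one point of the circle at most. -/
theorem eq_of_tendsto_cobounded (hf : IsConvexMapping f) (ha : secondCoeff f ≠ 0)
    (hline : ¬ ∃ e : ℂ, ‖e‖ = 1 ∧ ∀ w ∈ f '' ball 0 1, ∀ t : ℝ, w + t * e ∈ f '' ball 0 1)
    {ζ₁ ζ₂ : ℂ} (h₁ : ‖ζ₁‖ = 1) (h₂ : ‖ζ₂‖ = 1)
    (ht₁ : Tendsto f (𝓝[ball 0 1] ζ₁) (cobounded ℂ))
    (ht₂ : Tendsto f (𝓝[ball 0 1] ζ₂) (cobounded ℂ)) : ζ₁ = ζ₂ := by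
  have hb := hf.exists_line_or_isBounded.resolve_left hline
  refine hf.eq_of_convex_nhds_cobounded ha h₁ h₂ fun N => ?_
  -- Where the plane exceeds this `M`, `|w| ≥ N`. The corresponding half-plane is convex and
  -- contains all of the image outside a bounded set.
  set M : ℝ := 1 + 2 * (‖secondCoeff f‖ * N) with hM
  have hev : ∀ ζ : ℂ, Tendsto f (𝓝[ball 0 1] ζ) (cobounded ℂ) →
      ∀ᶠ z in 𝓝[ball 0 1] ζ, f z ∈ {w : ℂ | M < 1 + 2 * (secondCoeff f * w).re} := by
    intro ζ ht
    filter_upwards [ht.eventually (isBounded_def.1 (hb M)), self_mem_nhdsWithin] with z hz hzb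
    by_contra hle
    exact hz ⟨mem_image_of_mem f hzb, not_lt.1 hle⟩
  refine ⟨{w : ℂ | M < 1 + 2 * (secondCoeff f * w).re}, ?_, fun w hw => ?_, hev _ ht₁, hev _ ht₂⟩
  · intro x hx y hy s t hs ht hst
    have hx' : M < 1 + 2 * (secondCoeff f * x).re := hx
    have hy' : M < 1 + 2 * (secondCoeff f * y).re := hy
    have e : (secondCoeff f * (s • x + t • y)).re
        = s * (secondCoeff f * x).re + t * (secondCoeff f * y).re := by
      simp
      ring
    rw [Set.mem_ofPred_eq, e]
    obtain rfl : t = 1 - s := by linarith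
    rcases hs.eq_or_lt with rfl | hs'
    · simpa using hy'
    · nlinarith
  · have hw' : M < 1 + 2 * (secondCoeff f * w).re := hw
    have h1 := (Complex.re_le_norm (secondCoeff f * w)).trans (norm_mul _ _).le
    have h2 : ‖secondCoeff f‖ * N ≤ ‖secondCoeff f‖ * ‖w‖ := by linarith
    exact le_of_mul_le_mul_left h2 (norm_pos_iff.2 ha)

/-- A strip is not invariant under dilations about a boundary point. -/
theorem not_dilation_of_strip (hf : IsConvexMapping f) {u w : ℂ} {c d : ℝ}
    (hΩ : f '' ball 0 1 = parallelStrip u c d) (hw : w ∉ f '' ball 0 1) :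
    ¬ ∀ x ∈ f '' ball 0 1, ∀ r : ℝ, 0 < r → w + r * (x - w) ∈ f '' ball 0 1 := by
  intro h
  have h0 := hf.zero_mem_image
  have h0' := h0
  rw [hΩ] at h0'
  have hc : c < ((starRingEnd ℂ) u * 0).im ∧ ((starRingEnd ℂ) u * 0).im < d := h0'
  rw [mul_zero, Complex.zero_im] at hc
  set y := ((starRingEnd ℂ) u * w).im with hy
  have key : ∀ r : ℝ, 0 < r → c < y - r * y ∧ y - r * y < d := by
    intro r hr
    have h1 := h 0 h0 r hr
    rw [hΩ] at h1
    have h2 : c < ((starRingEnd ℂ) u * (w + r * (0 - w))).im ∧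
      ((starRingEnd ℂ) u * (w + r * (0 - w))).im < d := h1
    rw [zero_sub, mul_neg, ← sub_eq_add_neg, mul_sub, mul_left_comm, Complex.sub_im,
      Complex.im_ofReal_mul] at h2
    exact h2
  apply hw
  rw [hΩ]
  -- Dilating 0 about `w` gives heights `y - r y` for all `r > 0`, which stay in the bounded
  -- interval only if `y = 0`; but then `w` is in the strip.
  have hy0 : y = 0 := by
    by_contra hne
    rcases lt_or_gt_of_ne hne with hlt | hgt
    · have h1 := (key ((y - d) / y + 1) (by
        have : 0 < (y - d) / y := div_pos_of_neg_of_neg (by linarith) hlt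
        linarith)).2
      rw [add_mul, div_mul_cancel₀ _ hne] at h1
      have h2 := (key ((y - d) / y) (div_pos_of_neg_of_neg (by linarith) hlt)).2
      rw [div_mul_cancel₀ _ hne] at h2
      linarith
    · have h2 := (key ((y - c) / y) (div_pos (by linarith) hgt)).1
      rw [div_mul_cancel₀ _ hne] at h2
      linarith
  exact ⟨hc.1.trans_eq hy0.symm, hy0.trans_lt hc.2⟩

/-- In a strip, `f` tends to one of the two ends wherever it tends to infinity. -/
theorem tendsto_end_of_strip (hf : IsConvexMapping f) {u ζ : ℂ} {c d : ℝ} (hu : u ≠ 0)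
    (hΩ : f '' ball 0 1 = parallelStrip u c d)
    (h : Tendsto f (𝓝[ball 0 1] ζ) (cobounded ℂ)) :
    Tendsto (fun z => ((starRingEnd ℂ) u * f z).re) (𝓝[ball 0 1] ζ) atTop ∨
      Tendsto (fun z => ((starRingEnd ℂ) u * f z).re) (𝓝[ball 0 1] ζ) atBot := by
  set L : ℂ → ℝ := fun z => ((starRingEnd ℂ) u * f z).re with hL
  have habs : Tendsto (fun z => |L z|) (𝓝[ball 0 1] ζ) atTop := by
    have h1 := (tendsto_norm_atTop_iff_cobounded.2 h).const_mul_atTop (norm_pos_iff.2 hu)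
    have h2 := tendsto_atTop_add_const_right _ (-max |c| |d|) h1
    refine tendsto_atTop_mono' _ ?_ h2
    filter_upwards [self_mem_nhdsWithin] with z hz
    have h3 := mem_image_of_mem f hz
    rw [hΩ] at h3
    have h4 : |((starRingEnd ℂ) u * f z).im| ≤ max |c| |d| := abs_le_max_abs_abs h3.1.le h3.2.le
    have h5 := Complex.norm_le_abs_re_add_abs_im ((starRingEnd ℂ) u * f z)
    rw [norm_mul, Complex.norm_conj] at h5
    show ‖u‖ * ‖f z‖ + -max |c| |d| ≤ |L z|
    linarith
  -- Near `ζ` the coordinate along the strip has no zero on a convex piece of the disk, hence has a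
  -- constant sign.
  obtain ⟨δ, hδ, hne⟩ := Metric.mem_nhdsWithin_iff.1 (habs.eventually_gt_atTop 0)
  have hpre : IsPreconnected (ball ζ δ ∩ ball 0 1) :=
    ((convex_ball ζ δ).inter (convex_ball 0 1)).isPreconnected
  have hLc : ContinuousOn L (ball ζ δ ∩ ball 0 1) :=
    Complex.continuous_re.comp_continuousOn
      (continuousOn_const.mul (hf.differentiableOn.continuousOn.mono inter_subset_right))
  have hmem : ball ζ δ ∩ ball 0 1 ∈ 𝓝[ball 0 1] ζ :=
    inter_mem (mem_nhdsWithin_of_mem_nhds (ball_mem_nhds ζ hδ)) self_mem_nhdsWithin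
  by_cases hsign : ∃ x ∈ ball ζ δ ∩ ball 0 1, 0 < L x
  · left
    obtain ⟨x, hx, hx0⟩ := hsign
    refine habs.congr' ?_
    filter_upwards [hmem] with z hz
    refine abs_of_nonneg (not_lt.1 fun hlt => ?_)
    obtain ⟨y, hy, hy0⟩ := hpre.intermediate_value hz hx hLc ⟨hlt.le, hx0.le⟩
    have : 0 < |L y| := hne hy
    rw [hy0, abs_zero] at this
    exact lt_irrefl _ this
  · right
    rw [← tendsto_neg_atTop_iff]
    refine habs.congr' ?_
    filter_upwards [hmem] with z hz
    exact abs_of_nonpos (not_lt.1 fun hlt => hsign ⟨z, hz, hlt⟩)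

/-- Follow the points `s n u` on the line through 0; the sign of `s` selects the end and is kept
along the sequence to identify it later. -/
theorem exists_end_of_strip (hf : IsConvexMapping f) (ha : secondCoeff f ≠ 0) {u : ℂ} {c d : ℝ}
    (hu : u ≠ 0) (hΩ : f '' ball 0 1 = parallelStrip u c d) {s : ℝ} (hs : s ≠ 0) :
    ∃ ζ : ℂ, ‖ζ‖ = 1 ∧ Tendsto f (𝓝[ball 0 1] ζ) (cobounded ℂ) ∧
      ∃ z : ℕ → ℂ, Tendsto z atTop (𝓝[ball 0 1] ζ) ∧
        ∀ n, 0 ≤ s * ((starRingEnd ℂ) u * f (z n)).re := by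
  have h0 := hf.zero_mem_image
  rw [hΩ] at h0
  have hc : c < ((starRingEnd ℂ) u * 0).im ∧ ((starRingEnd ℂ) u * 0).im < d := h0
  rw [mul_zero, Complex.zero_im] at hc
  have huu : (starRingEnd ℂ) u * u = (‖u‖ ^ 2 : ℝ) := by
    rw [mul_comm, Complex.mul_conj, Complex.normSq_eq_norm_sq]
  have hmul : ∀ n : ℕ, (starRingEnd ℂ) u * ((s * n : ℝ) * u) = ((s * n * ‖u‖ ^ 2 : ℝ) : ℂ) := by
    intro n
    rw [mul_left_comm, huu]
    push_cast
    ring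
  have hex : ∀ n : ℕ, ((s * n : ℝ) * u : ℂ) ∈ f '' ball 0 1 := by
    intro n
    rw [hΩ, parallelStrip, Set.mem_ofPred_eq, hmul, Complex.ofReal_im]
    exact hc
  choose z hz hzn using hex
  obtain ⟨ζ, hζ, h, φ, hφ, hlim⟩ := hf.exists_tendsto_cobounded ha (z := z)
    (fun n => by simpa using hz n) (by
      rw [← tendsto_norm_atTop_iff_cobounded]
      have h1 : Tendsto (fun n : ℕ => (|s| * ‖u‖) * (n : ℝ)) atTop atTop :=
        tendsto_natCast_atTop_atTop.const_mul_atTop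
          (mul_pos (abs_pos.2 hs) (norm_pos_iff.2 hu))
      refine h1.congr fun n => ?_
      rw [Function.comp_apply, hzn, norm_mul, Complex.norm_real, Real.norm_eq_abs, abs_mul,
        Nat.abs_cast]
      ring)
  refine ⟨ζ, hζ, hf.tendsto_cobounded_of_fStarExt ha hζ h, z ∘ φ, hlim, fun n => ?_⟩
  rw [Function.comp_apply, hzn, hmul, Complex.ofReal_re]
  have : s * (s * (φ n) * ‖u‖ ^ 2) = s ^ 2 * (φ n) * ‖u‖ ^ 2 := by ring
  rw [this]
  positivity

theorem eq_of_tendsto_end (hf : IsConvexMapping f) (ha : secondCoeff f ≠ 0) {u ζ₁ ζ₂ : ℂ}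
    (hu : u ≠ 0) (h₁ : ‖ζ₁‖ = 1) (h₂ : ‖ζ₂‖ = 1)
    (ht₁ : Tendsto (fun z => ((starRingEnd ℂ) u * f z).re) (𝓝[ball 0 1] ζ₁) atTop)
    (ht₂ : Tendsto (fun z => ((starRingEnd ℂ) u * f z).re) (𝓝[ball 0 1] ζ₂) atTop) : ζ₁ = ζ₂ := by
  refine hf.eq_of_convex_nhds_cobounded ha h₁ h₂ fun N =>
    ⟨halfPlane u (‖u‖ * N), ?_, fun w hw => ?_, ht₁.eventually_gt_atTop _,
      ht₂.eventually_gt_atTop _⟩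
  · intro x hx y hy s t hs ht hst
    have hx' : ‖u‖ * N < ((starRingEnd ℂ) u * x).re := hx
    have hy' : ‖u‖ * N < ((starRingEnd ℂ) u * y).re := hy
    have e : ((starRingEnd ℂ) u * (s • x + t • y)).re
        = s * ((starRingEnd ℂ) u * x).re + t * ((starRingEnd ℂ) u * y).re := by
      simp
      ring
    rw [halfPlane, Set.mem_ofPred_eq, e]
    obtain rfl : t = 1 - s := by linarith
    rcases hs.eq_or_lt with rfl | hs'
    · simpa using hy'
    · nlinarith
  · have hw' : ‖u‖ * N < ((starRingEnd ℂ) u * w).re := hw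
    have h1 := (Complex.re_le_norm ((starRingEnd ℂ) u * w)).trans (norm_mul _ _).le
    rw [Complex.norm_conj] at h1
    exact le_of_mul_le_mul_left (hw'.le.trans h1) (norm_pos_iff.2 hu)

/-- A finite limit at a point of critical modulus would be a centre of dilations, which a strip
lacks; so only the two ends remain, the second being treated by replacing `u` with `-u`. -/
theorem strip_case (hf : IsConvexMapping f) (ha : secondCoeff f ≠ 0) {u : ℂ} {c d : ℝ}
    (hu : u ≠ 0) (hΩ : f '' ball 0 1 = parallelStrip u c d) :
    ∃ ζ₁ ∈ sphere (0 : ℂ) 1, ∃ ζ₂ ∈ sphere (0 : ℂ) 1, ζ₁ ≠ ζ₂ ∧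
      Tendsto (fun z => ((starRingEnd ℂ) u * f z).re) (𝓝[ball 0 1] ζ₁) atTop ∧
      Tendsto (fun z => ((starRingEnd ℂ) u * f z).re) (𝓝[ball 0 1] ζ₂) atBot ∧
      ∀ ζ ∈ sphere (0 : ℂ) 1, ‖secondCoeff f * fStarExt f ζ‖ = 1 ↔ ζ = ζ₁ ∨ ζ = ζ₂ := by
  obtain ⟨ζ₁, h₁, hc₁, z, hz, hzs⟩ := hf.exists_end_of_strip ha hu hΩ one_ne_zero
  obtain ⟨ζ₂, h₂, hc₂, z', hz', hzs'⟩ := hf.exists_end_of_strip ha hu hΩ (s := -1) (by norm_num)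
  have ht₁ := (hf.tendsto_end_of_strip hu hΩ hc₁).resolve_right fun hbot => by
    obtain ⟨n, hn⟩ := ((hbot.comp hz).eventually_lt_atBot 0).exists
    have := hzs n
    simp only [Function.comp_apply] at hn
    linarith
  have ht₂ := (hf.tendsto_end_of_strip hu hΩ hc₂).resolve_left fun htop => by
    obtain ⟨n, hn⟩ := ((htop.comp hz').eventually_gt_atTop 0).exists
    have := hzs' n
    simp only [Function.comp_apply] at hn
    linarith
  have hneg : ∀ ζ : ℂ, Tendsto (fun z => ((starRingEnd ℂ) u * f z).re) (𝓝[ball 0 1] ζ) atBot →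
      Tendsto (fun z => ((starRingEnd ℂ) (-u) * f z).re) (𝓝[ball 0 1] ζ) atTop := by
    intro ζ h
    refine (tendsto_neg_atBot_atTop.comp h).congr fun z => ?_
    simp only [Function.comp_apply, map_neg, neg_mul, Complex.neg_re]
  refine ⟨ζ₁, by simpa using h₁, ζ₂, by simpa using h₂, ?_, ht₁, ht₂, fun ζ hζ => ?_⟩
  · rintro rfl
    have := nhdsWithin_ball_neBot h₁.le
    exact ht₁.not_tendsto disjoint_atTop_atBot ht₂
  · have hζ1 : ‖ζ‖ = 1 := by simpa using hζ
    constructor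
    · intro h
      rcases hf.tendsto_cobounded_or_dilation ha hζ1 h with hinf | ⟨w, -, hw, -, hdil⟩
      · refine (hf.tendsto_end_of_strip hu hΩ hinf).imp (fun h => ?_) fun h => ?_
        · exact hf.eq_of_tendsto_end ha hu hζ1 h₁ h ht₁
        · exact hf.eq_of_tendsto_end ha (neg_ne_zero.2 hu) hζ1 h₂ (hneg _ h) (hneg _ ht₂)
      · exact absurd hdil (hf.not_dilation_of_strip hΩ hw)
    · rintro (rfl | rfl)
      · exact hf.norm_fStarExt_of_tendsto_cobounded ha hζ1 hc₁
      · exact hf.norm_fStarExt_of_tendsto_cobounded ha hζ1 hc₂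

/-- Translation or dilation symmetry would put the image in an excluded class, so only limits at
infinity occur, and without a line there is only one. -/
theorem generic_case (hf : IsConvexMapping f) (ha : secondCoeff f ≠ 0)
    (hunb : ¬ IsBounded (f '' ball 0 1)) (hH : ¬ IsHalfPlane (f '' ball 0 1))
    (hS : ¬ IsSector (f '' ball 0 1)) (hP : ¬ IsParallelStrip (f '' ball 0 1)) :
    ∃ ζ₀ ∈ sphere (0 : ℂ) 1, Tendsto f (𝓝[ball 0 1] ζ₀) (cobounded ℂ) ∧
      ∀ ζ ∈ sphere (0 : ℂ) 1, ‖secondCoeff f * fStarExt f ζ‖ = 1 ↔ ζ = ζ₀ := by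
  have hne : (f '' ball 0 1).Nonempty := ⟨0, hf.zero_mem_image⟩
  have hline : ¬ ∃ e : ℂ, ‖e‖ = 1 ∧
      ∀ w ∈ f '' ball 0 1, ∀ t : ℝ, w + t * e ∈ f '' ball 0 1 := by
    rintro ⟨e, he, h⟩
    exact (isParallelStrip_or_isHalfPlane_of_line hf.isOpen_image hf.convex_image hne he ha h
      fun w hw => hf.affine_pos hw).elim hP hH
  obtain ⟨ζ₀, h₀, ht₀⟩ := hf.exists_tendsto_cobounded_of_not_isBounded ha hunb
  refine ⟨ζ₀, by simpa using h₀, ht₀, fun ζ hζ => ?_⟩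
  have hζ1 : ‖ζ‖ = 1 := by simpa using hζ
  constructor
  · intro h
    rcases hf.tendsto_cobounded_or_dilation ha hζ1 h with hinf | ⟨w, -, -, hw, hdil⟩
    · exact hf.eq_of_tendsto_cobounded ha hline hζ1 h₀ hinf ht₀
    · refine ((isHalfPlane_or_isSector_of_dilation hf.isOpen_image hf.convex_image hne ha hdil
        fun x hx => ?_).elim hH hS).elim
      have := hf.affine_pos hx
      rw [mul_sub, Complex.sub_re]
      linarith
  · rintro rfl
    exact hf.norm_fStarExt_of_tendsto_cobounded ha hζ1 ht₀

theorem sector_case (hf : IsConvexMapping f) (ha : secondCoeff f ≠ 0)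
    (hunb : ¬ IsBounded (f '' ball 0 1)) {v u : ℂ} {α : ℝ} (hu : u ≠ 0) (hα : 0 < α)
    (hα' : α < Real.pi) (hΩ : f '' ball 0 1 = sector v u α) :
    ∃ ζ₁ ∈ sphere (0 : ℂ) 1, ∃ ζ₂ ∈ sphere (0 : ℂ) 1, ζ₁ ≠ ζ₂ ∧
      Tendsto f (𝓝[ball 0 1] ζ₁) (𝓝 v) ∧ Tendsto f (𝓝[ball 0 1] ζ₂) (cobounded ℂ) ∧
      ∀ ζ ∈ sphere (0 : ℂ) 1, ‖secondCoeff f * fStarExt f ζ‖ = 1 ↔ ζ = ζ₁ ∨ ζ = ζ₂ := by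
  have hdil : ∀ w ∈ f '' ball 0 1, ∀ r : ℝ, 0 < r → v + r * (w - v) ∈ f '' ball 0 1 := by
    rw [hΩ]
    exact sector_dilation
  have hnoline : ∀ e : ℂ, e ≠ 0 → ¬ ∀ w ∈ f '' ball 0 1, ∀ t : ℝ, w + t * e ∈ f '' ball 0 1 := by
    intro e he h
    refine sector_not_line (v := v) hu hα hα' he fun t => ?_
    have := h 0 hf.zero_mem_image t
    rwa [zero_add, hΩ] at this
  have hline : ¬ ∃ e : ℂ, ‖e‖ = 1 ∧
      ∀ w ∈ f '' ball 0 1, ∀ t : ℝ, w + t * e ∈ f '' ball 0 1 := by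
    rintro ⟨e, he, h⟩
    refine hnoline e ?_ h
    rintro rfl
    simp at he
  have hv : v ∉ f '' ball 0 1 := by
    rw [hΩ]
    exact fun h => h.1 rfl
  have hvcl : v ∈ closure (f '' ball 0 1) := by
    have hl : Tendsto (fun r : ℝ => v + r * (0 - v)) (𝓝[>] 0) (𝓝 (v + (0 : ℝ) * (0 - v))) :=
      (Continuous.tendsto (by fun_prop) (0 : ℝ)).mono_left nhdsWithin_le_nhds
    rw [Complex.ofReal_zero, zero_mul, add_zero] at hl
    refine mem_closure_of_tendsto hl ?_
    filter_upwards [self_mem_nhdsWithin] with r hr using hdil 0 hf.zero_mem_image r hr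
  have hv0 := hf.affine_eq_zero_of_dilation hvcl hdil
  obtain ⟨ζ₁, h₁, ht₁⟩ := hf.exists_tendsto_of_mem_closure ha hvcl hv
  obtain ⟨ζ₂, h₂, ht₂⟩ := hf.exists_tendsto_cobounded_of_not_isBounded ha hunb
  refine ⟨ζ₁, by simpa using h₁, ζ₂, by simpa using h₂, ?_, ht₁, ht₂, fun ζ hζ => ?_⟩
  · rintro rfl
    have := nhdsWithin_ball_neBot h₁.le
    exact ht₁.not_tendsto (disjoint_nhds_cobounded _) ht₂
  · have hζ1 : ‖ζ‖ = 1 := by simpa using hζ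
    constructor
    · intro h
      rcases hf.tendsto_cobounded_or_dilation ha hζ1 h with hinf | ⟨w, hw, -, -, hdil'⟩
      · exact Or.inr (hf.eq_of_tendsto_cobounded ha hline hζ1 h₂ hinf ht₂)
      · left
        obtain rfl : w = v := by
          by_contra hne
          refine hnoline (w - v) (sub_ne_zero.2 hne) fun x hx t => ?_
          -- Two distinct centres would produce a line: the dilation about `p` of ratio `1/(1+s)`
          -- followed by that about `q` of ratio `1+s` is the translation by `s (p - q)`.
          have key : ∀ p q : ℂ,
              (∀ x ∈ f '' ball 0 1, ∀ r : ℝ, 0 < r → p + r * (x - p) ∈ f '' ball 0 1) →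
              (∀ x ∈ f '' ball 0 1, ∀ r : ℝ, 0 < r → q + r * (x - q) ∈ f '' ball 0 1) →
              ∀ s : ℝ, 0 ≤ s → x + s * (p - q) ∈ f '' ball 0 1 := by
            intro p q hp hq s hs
            have hs1 : 0 < 1 + s := by linarith
            have hs0 : (1 + s : ℂ) ≠ 0 := by exact_mod_cast hs1.ne'
            have h4 := hq _ (hp x hx (1 + s)⁻¹ (inv_pos.2 hs1)) (1 + s) hs1
            convert h4 using 1
            push_cast
            field_simp
            ring
          rcases le_or_gt 0 t with ht | ht
          · exact key w v hdil' hdil t ht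
          · have := key v w hdil hdil' (-t) (by linarith)
            convert this using 1
            push_cast
            ring
        exact hf.eq_of_tendsto_nhds ha hζ1 h₁ hv0 hw ht₁
    · rintro (rfl | rfl)
      · exact (hf.norm_fStarExt_eq_one_iff ha hζ1 ht₁).2 hv0
      · exact hf.norm_fStarExt_of_tendsto_cobounded ha hζ1 ht₂

/-- Every boundary point of a half-plane is a centre of dilations, so the plane vanishes on the
entire boundary line. -/
theorem halfPlane_case (hf : IsConvexMapping f) (ha : secondCoeff f ≠ 0)
    (hH : IsHalfPlane (f '' ball 0 1)) {ζ : ℂ} (hζ : ‖ζ‖ = 1) :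
    ‖secondCoeff f * fStarExt f ζ‖ = 1 := by
  obtain ⟨u, c, -, hΩ⟩ := hH
  have := nhdsWithin_ball_neBot hζ.le
  by_cases h1 : secondCoeff f * fStarExt f ζ = 1
  · rw [h1, norm_one]
  · have h2 := hf.tendsto_of_fStarExt ha hζ h1
    set w := fStarExt f ζ / (1 - secondCoeff f * fStarExt f ζ)
    have hw := hf.not_mem_image_of_tendsto hζ le_rfl h2
    have hwcl := mem_closure_of_tendsto_ball hζ h2
    refine (hf.norm_fStarExt_eq_one_iff ha hζ h2).2 (hf.affine_eq_zero_of_dilation hwcl ?_)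
    rw [hΩ] at hw hwcl ⊢
    have hle : ((starRingEnd ℂ) u * w).re ≤ c := not_lt.1 hw
    have hcl : IsClosed {w : ℂ | c ≤ ((starRingEnd ℂ) u * w).re} :=
      isClosed_le continuous_const (by fun_prop)
    have hge : c ≤ ((starRingEnd ℂ) u * w).re :=
      closure_minimal (fun x (hx : c < ((starRingEnd ℂ) u * x).re) => hx.le) hcl hwcl
    exact halfPlane_dilation (le_antisymm hle hge)

end IsConvexMapping

theorem theorem2p3 (f : ℂ → ℂ) (hf : IsConvexMapping f)
    (hunb : ¬ Bornology.IsBounded (f '' Metric.ball 0 1)) (ha : secondCoeff f ≠ 0) :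
    -- `f*` is well defined on the disk, and `|a₂ f*| < 1` there
    (∀ z ∈ Metric.ball (0 : ℂ) 1,
      1 + secondCoeff f * f z ≠ 0 ∧ ‖secondCoeff f * fStar f z‖ < 1) ∧
    -- `f*` has a continuous extension to the closed disk, which gives its boundary values
    ContinuousOn (fStarExt f) (Metric.closedBall 0 1) ∧
    Set.EqOn (fStarExt f) (fStar f) (Metric.ball 0 1) ∧
    -- the value 1 is attained on the circle
    (∃ ζ ∈ Metric.sphere (0 : ℂ) 1, ‖secondCoeff f * fStarExt f ζ‖ = 1) ∧
    -- (i) the generic case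
    (¬ IsHalfPlane (f '' Metric.ball 0 1) → ¬ IsSector (f '' Metric.ball 0 1) →
      ¬ IsParallelStrip (f '' Metric.ball 0 1) →
      ∃ ζ₀ ∈ Metric.sphere (0 : ℂ) 1,
        Tendsto f (𝓝[Metric.ball 0 1] ζ₀) (Bornology.cobounded ℂ) ∧
        ∀ ζ ∈ Metric.sphere (0 : ℂ) 1, ‖secondCoeff f * fStarExt f ζ‖ = 1 ↔ ζ = ζ₀) ∧
    -- (ii) strips: one solution for each end
    (∀ (u : ℂ) (c d : ℝ), u ≠ 0 → c < d → f '' Metric.ball 0 1 = parallelStrip u c d →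
      ∃ ζ₁ ∈ Metric.sphere (0 : ℂ) 1, ∃ ζ₂ ∈ Metric.sphere (0 : ℂ) 1, ζ₁ ≠ ζ₂ ∧
        Tendsto (fun z => ((starRingEnd ℂ) u * f z).re) (𝓝[Metric.ball 0 1] ζ₁) atTop ∧
        Tendsto (fun z => ((starRingEnd ℂ) u * f z).re) (𝓝[Metric.ball 0 1] ζ₂) atBot ∧
        ∀ ζ ∈ Metric.sphere (0 : ℂ) 1,
          ‖secondCoeff f * fStarExt f ζ‖ = 1 ↔ ζ = ζ₁ ∨ ζ = ζ₂) ∧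
    -- (iii) sectors: the vertex and the point at infinity
    (∀ (v u : ℂ) (α : ℝ), u ≠ 0 → 0 < α → α < Real.pi →
      f '' Metric.ball 0 1 = sector v u α →
      ∃ ζ₁ ∈ Metric.sphere (0 : ℂ) 1, ∃ ζ₂ ∈ Metric.sphere (0 : ℂ) 1, ζ₁ ≠ ζ₂ ∧
        Tendsto f (𝓝[Metric.ball 0 1] ζ₁) (𝓝 v) ∧
        Tendsto f (𝓝[Metric.ball 0 1] ζ₂) (Bornology.cobounded ℂ) ∧
        ∀ ζ ∈ Metric.sphere (0 : ℂ) 1,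
          ‖secondCoeff f * fStarExt f ζ‖ = 1 ↔ ζ = ζ₁ ∨ ζ = ζ₂) ∧
    -- (iv) half-planes: the whole circle
    (IsHalfPlane (f '' Metric.ball 0 1) →
      ∀ ζ ∈ Metric.sphere (0 : ℂ) 1, ‖secondCoeff f * fStarExt f ζ‖ = 1) := by
  refine ⟨fun z hz => ⟨hf.one_add_ne_zero (by simpa using hz),
    hf.norm_mul_fStar_lt_one (by simpa using hz)⟩, hf.continuousOn_fStarExt ha, hf.eqOn_fStarExt,
    ?_, hf.generic_case ha hunb, fun u c d hu _ hΩ => hf.strip_case ha hu hΩ,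
    fun v u α hu hα hα' hΩ => hf.sector_case ha hunb hu hα hα' hΩ,
    fun hH ζ hζ => hf.halfPlane_case ha hH (by simpa using hζ)⟩
  obtain ⟨ζ, hζ, h⟩ := hf.exists_tendsto_cobounded_of_not_isBounded ha hunb
  exact ⟨ζ, by simpa using hζ, hf.norm_fStarExt_of_tendsto_cobounded ha hζ h⟩
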